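/- Let $I\subseteq\mathbb R$ be a nonempty open interval and let $h,c,p,s$ be smooth real functions on $I$, such that $c$ has no zero in $I$ and $h'''$ does not vanish identically on any nonempty open subinterval of $I$. For a function $f$ of $u$ put $$D(f)=D_{(c,p,s)}(f)=f-\tfrac{\varepsilon^2}{2}\,c\,f'''\,u_x^2+\varepsilon^4\left(p_f\,u_{xx}^2+s_f\,u_x^4\right),$$ $$p_f=p f'''+\tfrac{3}{10}c^2f^{(4)},\qquad s_f=s f'''-\tfrac{cc''}{8}f^{(4)}-\tfrac{cc'}{8}f^{(5)}-\tfrac{c^2}{24}f^{(6)}-\tfrac{p'}{6}f^{(4)}-\tfrac{p}{6}f^{(5)}.$$ Let $\mathcal E(F)=\sum_{k\ge0}(-1)^k\frac{d^k}{dx^k}\frac{\partial F}{\partial u^{(k)}}$ be the Euler–Lagrange operator, $\frac{\delta}{\delta u}\int F\,dx=\mathcal E(F)$, and consider, for $u$ with values in $I$, the Hamiltonian perturbation $$u_t=\partial_x\frac{\delta H_h}{\delta u},\qquad H_h=\int D_{(c,p,s)}(h)\,dx. \tag{1}$$ Consider functionals of the normal form $$S=\int\left(x\,\alpha+\varepsilon^4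 e(u)\,u_x^3+t\,\beta\right)dx,\tag{2}$$ $$\alpha=\alpha_0+\varepsilon^2\alpha_1u_x^2+\varepsilon^4(\alpha_2u_x^4+\alpha_3u_{xx}^2),\qquad \beta=\beta_0+\varepsilon^2\beta_1u_x^2+\varepsilon^4(\beta_2u_x^4+\beta_3u_{xx}^2),$$ where $\alpha_i,\beta_i,e$ are smooth functions of $u\in I$. Functionals are identified when they have the same variational derivative, so that $S$ is nonzero if $\delta S/\delta u\not\equiv0$. Call $S$ an $O(\varepsilon^4)$-conserved quantity of (1) if it is conserved up to $O(\varepsilon^6)$, that is, if $$\partial_t\frac{\delta S}{\delta u}+\mathcal E\left(\frac{\delta S}{\delta u}\,\frac{d}{dx}\frac{\delta H_h}{\delta u}\right)=O(\varepsilon^6)\qquad(\varepsilon\to0)$$ identically in $x$, $t$ and the jet variables $u\in I$, $u_x,u_{xx},\dots\in\mathbb R$. Then: (i) Equation (1) has a nonzero $O(\varepsilon^4)$-conserved quantity of the form (2) if and only if there is a constant $\lambda\in\mathbb R$ with $$p=\tfrac35\,c\,c'+\lambda\,c^3\quad\text{on } I.$$ (ii) In that case, for the constant $\lambda$ of (i),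 put $$e_0=\tfrac12\Big[\tfrac{53}{24}\tfrac{c''(c')^2}{c^2}-\tfrac{8}{15}\tfrac{(c')^4}{c^3}+\tfrac{s'}{c}-\tfrac{157}{120}\tfrac{(c'')^2}{c}-5\tfrac{s\,c'}{c^2}-\tfrac{173}{120}\tfrac{c'c'''}{c}+\tfrac{5}{12}c^{(4)}+\lambda\Big(-\tfrac{13}{2}c''c'+\tfrac{2(c')^3}{c}+\tfrac{11}{6}c\,c'''\Big)\Big].$$ Functions $r,q$ on $I$ with $r'=1/c$ and $q'=h''/c$ exist, and for any such $r,q$ there is a functional (2), with smooth coefficients, that has $\alpha=D(r)$, $\beta=D(q)$, $e=e_0$. A functional (2) is a nonzero $O(\varepsilon^4)$-conserved quantity of (1) if and only if there are a constant $k\neq0$ and functions $r,q$ on $I$ with $r'=1/c$, $q'=h''/c$ such that $$\alpha=k\,D(r),\qquad \beta=k\,D(q),\qquad e=k\,e_0 .$$ (iii) Hence the quantity is unique up to a multiplicative constant: under the condition of (i), any $O(\varepsilon^4)$-conserved quantity of the form (2) is a constant multiple of any nonzero one. -/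

import Mathlib

open Filter Topology Asymptotics
open scoped ContDiff

noncomputable section

/-- A density `F(x, t; u, u_x, u_xx, …)`: a function of `x`, `t` and the jet coordinates, where
`j k` stands for the `k`-th `x`-derivative of `u` (so `j 0 = u`, `j 1 = u_x`, `j 2 = u_xx`). -/
abbrev Density : Type := ℝ → ℝ → (ℕ → ℝ) → ℝ

/-- The partial derivative `∂F/∂u^{(k)}`. -/
def jetDeriv (k : ℕ) (F : Density) : Density := fun x t j =>
  deriv (fun y => F x t (Function.update j k y)) (j k)

/-- The total derivative `dF/dx = ∂F/∂x + ∑_k u^{(k+1)} ∂F/∂u^{(k)}`; the sum is finite for a density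
that depends on finitely many jet coordinates. -/
def totalDeriv (F : Density) : Density := fun x t j =>
  deriv (fun y => F y t j) x + ∑ᶠ k : ℕ, j (k + 1) * jetDeriv k F x t j

/-- The Euler-Lagrange operator `∑_k (-1)^k (d/dx)^k (∂F/∂u^{(k)})`, that is, the variational
derivative of the local functional `∫ F dx`. -/
def euler (F : Density) : Density := fun x t j =>
  ∑ᶠ k : ℕ, (-1 : ℝ) ^ k * (totalDeriv^[k] (jetDeriv k F)) x t j

/-- `c_f = c f'''`. -/
def coefC (c f : ℝ → ℝ) (v : ℝ) : ℝ := c v * iteratedDeriv 3 f v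

/-- `p_f = p f''' + (3/10) c² f⁗`. -/
def coefP (c p f : ℝ → ℝ) (v : ℝ) : ℝ :=
  p v * iteratedDeriv 3 f v + 3 / 10 * c v ^ 2 * iteratedDeriv 4 f v

/-- `s_f = s f''' - (c c''/8) f⁽⁴⁾ - (c c'/8) f⁽⁵⁾ - (c²/24) f⁽⁶⁾ - (p'/6) f⁽⁴⁾ - (p/6) f⁽⁵⁾`. -/
def coefS (c p s f : ℝ → ℝ) (v : ℝ) : ℝ :=
  s v * iteratedDeriv 3 f v
    - c v * iteratedDeriv 2 c v / 8 * iteratedDeriv 4 f v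
    - c v * deriv c v / 8 * iteratedDeriv 5 f v
    - c v ^ 2 / 24 * iteratedDeriv 6 f v
    - deriv p v / 6 * iteratedDeriv 4 f v
    - p v / 6 * iteratedDeriv 5 f v

/-- The `D`-operator
`D_{(c,p,s)}(f) = f - (ε²/2) c_f u_x² + ε⁴ (p_f u_xx² + s_f u_x⁴)`, as a density. -/
def dOp (c p s f : ℝ → ℝ) (ε : ℝ) : Density := fun _ _ j =>
  f (j 0) - ε ^ 2 / 2 * coefC c f (j 0) * j 1 ^ 2
    + ε ^ 4 * (coefP c p f (j 0) * j 2 ^ 2 + coefS c p s f (j 0) * j 1 ^ 4)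

/-- The right-hand side of the Hamiltonian perturbation
`u_t = {u, H_h} = ∂_x (δH_h/δu)`, where `H_h = ∫ D_{(c,p,s)}(h) dx`. -/
def hamFlow (h c p s : ℝ → ℝ) (ε : ℝ) : Density := totalDeriv (euler (dOp c p s h ε))

/-- The functional `S = ∫ (S ε) dx` (depending on the parameter `ε`) is conserved up to `O(ε^K)` by
the evolution equation `u_t = flow ε`, for `u` with values in `I`:
`∂_t (δS/δu) + E((δS/δu) · flow) = O(ε^K)` as `ε → 0`, identically in `x`, `t` and in the jet of `u`,
where `E` is the Euler-Lagrange operator. -/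
def IsConservedUpTo (I : Set ℝ) (K : ℕ) (flow S : ℝ → Density) : Prop :=
  ∀ (x t : ℝ) (j : ℕ → ℝ), j 0 ∈ I →
    (fun ε : ℝ =>
      deriv (fun τ => euler (S ε) x τ j) t
        + euler (fun x' t' j' => euler (S ε) x' t' j' * flow ε x' t' j') x t j)
      =O[𝓝 0] fun ε : ℝ => ε ^ K

/-- The coefficients of a functional in normal form
`∫ (x α + ε⁴ e(u) u_x³ + t β) dx`. -/
structure StringForm where
  /-- coefficients of `α` -/
  (α₀ α₁ α₂ α₃ : ℝ → ℝ)
  /-- coefficients of `β` -/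
  (β₀ β₁ β₂ β₃ : ℝ → ℝ)
  /-- coefficient of `ε⁴ u_x³` -/
  (e : ℝ → ℝ)

namespace StringForm

/-- All the coefficients are smooth on `I`. -/
def SmoothOn (N : StringForm) (I : Set ℝ) : Prop :=
  (ContDiffOn ℝ ∞ N.α₀ I ∧ ContDiffOn ℝ ∞ N.α₁ I ∧ ContDiffOn ℝ ∞ N.α₂ I ∧ ContDiffOn ℝ ∞ N.α₃ I) ∧
  (ContDiffOn ℝ ∞ N.β₀ I ∧ ContDiffOn ℝ ∞ N.β₁ I ∧ ContDiffOn ℝ ∞ N.β₂ I ∧ ContDiffOn ℝ ∞ N.β₃ I) ∧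
  ContDiffOn ℝ ∞ N.e I

/-- `α = α₀ + ε² α₁ u_x² + ε⁴ (α₂ u_x⁴ + α₃ u_xx²)`. -/
def alpha (N : StringForm) (ε : ℝ) : Density := fun _ _ j =>
  N.α₀ (j 0) + ε ^ 2 * (N.α₁ (j 0) * j 1 ^ 2)
    + ε ^ 4 * (N.α₂ (j 0) * j 1 ^ 4 + N.α₃ (j 0) * j 2 ^ 2)

/-- `β = β₀ + ε² β₁ u_x² + ε⁴ (β₂ u_x⁴ + β₃ u_xx²)`. -/
def beta (N : StringForm) (ε : ℝ) : Density := fun _ _ j =>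
  N.β₀ (j 0) + ε ^ 2 * (N.β₁ (j 0) * j 1 ^ 2)
    + ε ^ 4 * (N.β₂ (j 0) * j 1 ^ 4 + N.β₃ (j 0) * j 2 ^ 2)

/-- The density `x α + ε⁴ e(u) u_x³ + t β`. -/
def density (N : StringForm) (ε : ℝ) : Density := fun x t j =>
  x * N.alpha ε x t j + ε ^ 4 * (N.e (j 0) * j 1 ^ 3) + t * N.beta ε x t j

/-- The functional is not zero: its variational derivative does not vanish identically
on the jets of functions with values in `I`. -/
def NonzeroOn (N : StringForm) (I : Set ℝ) : Prop :=
  ∃ (ε x t : ℝ) (j : ℕ → ℝ), j 0 ∈ I ∧ euler (N.density ε) x t j ≠ 0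

/-- The functional of `N` is `k` times the functional of `M` (local functionals being
identified when they have the same variational derivative). -/
def IsMultipleOn (N M : StringForm) (k : ℝ) (I : Set ℝ) : Prop :=
  ∀ (ε x t : ℝ) (j : ℕ → ℝ), j 0 ∈ I →
    euler (N.density ε) x t j = k * euler (M.density ε) x t j

/-- `α = k D(r)`, `β = k D(q)` and `e = k e₀`, for `u` with values in `I`. -/
def IsDOpForm (N : StringForm) (c p s r q e₀ : ℝ → ℝ) (k : ℝ) (I : Set ℝ) : Prop :=
  (∀ (ε x t : ℝ) (j : ℕ → ℝ), j 0 ∈ I → N.alpha ε x t j = k * dOp c p s r ε x t j) ∧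
  (∀ (ε x t : ℝ) (j : ℕ → ℝ), j 0 ∈ I → N.beta ε x t j = k * dOp c p s q ε x t j) ∧
  (∀ v ∈ I, N.e v = k * e₀ v)

end StringForm

/-- The explicit coefficient `e` of `ε⁴ u_x³`. -/
def gaugeE (c s : ℝ → ℝ) (lam : ℝ) (v : ℝ) : ℝ :=
  1 / 2 * (53 / 24 * (iteratedDeriv 2 c v * deriv c v ^ 2 / c v ^ 2)
    - 8 / 15 * (deriv c v ^ 4 / c v ^ 3)
    + deriv s v / c v
    - 157 / 120 * (iteratedDeriv 2 c v ^ 2 / c v)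
    - 5 * (s v * deriv c v / c v ^ 2)
    - 173 / 120 * (deriv c v * iteratedDeriv 3 c v / c v)
    + 5 / 12 * iteratedDeriv 4 c v
    + lam * (-(13 / 2) * (iteratedDeriv 2 c v * deriv c v)
      + 2 * deriv c v ^ 3 / c v
      + 11 / 6 * (c v * iteratedDeriv 3 c v)))

/-- `p = (3/5) c c' + λ c³` on `I`. -/
def PRelation (c p : ℝ → ℝ) (lam : ℝ) (I : Set ℝ) : Prop :=
  ∀ v ∈ I, p v = 3 / 5 * c v * deriv c v + lam * c v ^ 3

/-- `r' = 1/c` and `q' = h''/c` on `I`. -/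
def IsGenerator (h c r q : ℝ → ℝ) (I : Set ℝ) : Prop :=
  ∀ v ∈ I, HasDerivAt r (1 / c v) v ∧ HasDerivAt q (iteratedDeriv 2 h v / c v) v

end

/-! `S` is affine in `t` with slope `β`, so `∂_t δS/δu = E(β)` and the conservation defect is `E` of
the single density `β + (δS/δu) d/dx(δH_h/δu)`. This density is an even polynomial in `ε` of degree
at most 8, so conservation up to `O(ε⁶)` says that `E` annihilates its coefficients at `ε⁰, ε², ε⁴`.

Because `E` kills total derivatives (`el_td`), the last two coefficients may be integrated by parts
to a reduced form: at order two, `u_x²` and `x`, `t` times `u_x³`; at order four, `u_xx²`, `u_x⁴`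
and `x`, `t` times `u_x u_xx²`, `u_x⁵`, all with coefficients depending on `u` (`bracket_order_two`,
`bracket_order_four`). On reduced forms `E` is injective, so conservation amounts to the ten
differential equations in `u` collected in `StringEquations`.

For `H_h = ∫ D(h)` the system is triangular, and every equation except the one of order zero carries
a factor `h'''`, which cancels because `h''' ≠ 0` on a dense set. The `x`- and `t`-parts express
that `∫ α` and `∫ β` commute with `H_h` to this order; they force `α = D(α₀)` and `β = D(β₀)`. Order
zero gives `β₀' = h'' α₀'`. The `u_x²` equation becomes `(c α₀')' h''' = 0`, hence `α₀' = k/c`. The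
`u_xx²` equation becomes `k c² (p/c³ - (3/5) c'/c²)' h''' = 0`, and `λ` is the resulting constant of
integration. The `u_x⁴` equation becomes `(e - k e₀) h''' = 0`. If `k = 0`, only `e` could survive
and the `u_x⁴` equation kills it, so `S` is zero; thus nonzero quantities are exactly those with `k
≠ 0`. Read backwards, the same factorizations give sufficiency.

The formal setting is the algebra generated by `x`, `t`, the `u^{(k)}` and the smooth functions of
`u ∈ I`: on it `∂/∂u^{(k)}` and `d/dx` are true derivations, and the identities above become ring
computations. -/

open TopologicalSpace (Opens)

noncomputable section

/-! ### Functions on the jets over `I` and their derivatives. -/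

/-- Jets `(x, t, (u, u_x, u_xx, …))` with `u ∈ I`. -/
abbrev JetSpace (I : Opens ℝ) : Type := {q : ℝ × ℝ × (ℕ → ℝ) // q.2.2 0 ∈ I}

namespace JetSpace

variable {I : Opens ℝ}

/-- The restriction of a density to the jets with `u ∈ I`. -/
def restrict (I : Opens ℝ) (F : Density) : JetSpace I → ℝ := fun q => F q.1.1 q.1.2.1 q.1.2.2

open Classical in
/-- The extension by zero of a function of the jets with `u ∈ I`. -/
def extend (a : JetSpace I → ℝ) : Density := fun x t j =>
  if hj : j 0 ∈ I then a ⟨(x, t, j), hj⟩ else 0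

@[simp] lemma restrict_extend (a : JetSpace I → ℝ) : restrict I (extend a) = a := by
  funext q
  have := q.2
  simp [restrict, extend, this]

lemma extend_apply (a : JetSpace I → ℝ) (q : JetSpace I) :
    extend a q.1.1 q.1.2.1 q.1.2.2 = a q := congrFun (restrict_extend a) q

lemma extend_add (a b : JetSpace I → ℝ) : extend (a + b) = extend a + extend b := by
  funext x t j
  by_cases hj : j 0 ∈ I <;> simp [extend, hj]

lemma extend_mul (a b : JetSpace I → ℝ) : extend (a * b) = extend a * extend b := by
  funext x t j
  by_cases hj : j 0 ∈ I <;> simp [extend, hj]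

lemma eventually_update_mem (j : ℕ → ℝ) (hj : j 0 ∈ I) (k : ℕ) :
    ∀ᶠ y in 𝓝 (j k), Function.update j k y 0 ∈ I := by
  rcases eq_or_ne k 0 with rfl | hk
  · simpa using (I.2.eventually_mem hj : ∀ᶠ y in 𝓝 (j 0), y ∈ I)
  · simp [Function.update_of_ne hk.symm, hj]

/-- Since `I` is open, a small change of one jet coordinate stays over `I`. Hence every derivative
at jets over `I`, and so `euler`, depends only on the restriction of the density. -/
lemma eventuallyEq_update {F G : Density} (hFG : restrict I F = restrict I G) (q : JetSpace I)
    (k : ℕ) :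
    (fun y => F q.1.1 q.1.2.1 (Function.update q.1.2.2 k y)) =ᶠ[𝓝 (q.1.2.2 k)]
      fun y => G q.1.1 q.1.2.1 (Function.update q.1.2.2 k y) := by
  filter_upwards [eventually_update_mem q.1.2.2 q.2 k] with y hy
  exact congrFun hFG ⟨(q.1.1, q.1.2.1, Function.update q.1.2.2 k y), hy⟩

lemma eq_of_restrict_eq {F G : Density} (hFG : restrict I F = restrict I G) (q : JetSpace I) :
    (fun y => F y q.1.2.1 q.1.2.2) = fun y => G y q.1.2.1 q.1.2.2 :=
  funext fun y => congrFun hFG ⟨(y, q.1.2.1, q.1.2.2), q.2⟩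

lemma restrict_jetDeriv_congr {F G : Density} (hFG : restrict I F = restrict I G) (k : ℕ) :
    restrict I (jetDeriv k F) = restrict I (jetDeriv k G) :=
  funext fun q => (eventuallyEq_update hFG q k).deriv_eq

lemma restrict_totalDeriv_congr {F G : Density} (hFG : restrict I F = restrict I G) :
    restrict I (totalDeriv F) = restrict I (totalDeriv G) := by
  funext q
  have h1 := eq_of_restrict_eq hFG q
  have h2 := fun k => congrFun (restrict_jetDeriv_congr hFG k) q
  simp only [restrict] at h2 ⊢
  simp only [totalDeriv, h1, h2]

/-- The partial derivative `∂/∂u^{(k)}` of a function of the jets. -/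
def partialJet (k : ℕ) (a : JetSpace I → ℝ) : JetSpace I → ℝ := restrict I (jetDeriv k (extend a))

/-- The partial derivative `∂/∂x` of a function of the jets. -/
def partialX (a : JetSpace I → ℝ) : JetSpace I → ℝ :=
  restrict I fun x t j => deriv (fun y => extend a y t j) x

/-- The total derivative `d/dx` of a function of the jets. -/
def total (a : JetSpace I → ℝ) : JetSpace I → ℝ := restrict I (totalDeriv (extend a))

lemma restrict_jetDeriv (k : ℕ) (F : Density) :
    restrict I (jetDeriv k F) = partialJet k (restrict I F) :=
  restrict_jetDeriv_congr (restrict_extend _).symm k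

lemma restrict_totalDeriv (F : Density) :
    restrict I (totalDeriv F) = total (restrict I F) :=
  restrict_totalDeriv_congr (restrict_extend _).symm

lemma partialX_restrict (F : Density) (q : JetSpace I) :
    partialX (restrict I F) q = deriv (fun y => F y q.1.2.1 q.1.2.2) q.1.1 := by
  have := eq_of_restrict_eq (restrict_extend (restrict I F)) q
  simp only [partialX]
  exact congrArg (fun f => deriv f q.1.1) this

lemma total_apply (a : JetSpace I → ℝ) (q : JetSpace I) :
    total a q = partialX a q + ∑ᶠ k : ℕ, q.1.2.2 (k + 1) * partialJet k a q := rfl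

/-- Differentiability in each variable, and dependence on finitely many jet coordinates. -/
structure Regular (a : JetSpace I → ℝ) : Prop where
  differentiable_x : ∀ q : JetSpace I,
    DifferentiableAt ℝ (fun y => extend a y q.1.2.1 q.1.2.2) q.1.1
  differentiable_jet : ∀ (q : JetSpace I) (k : ℕ),
    DifferentiableAt ℝ (fun y => extend a q.1.1 q.1.2.1 (Function.update q.1.2.2 k y)) (q.1.2.2 k)
  finite_order : ∃ n, ∀ k ≥ n, partialJet k a = 0

lemma partialJet_add {a b : JetSpace I → ℝ} (ha : Regular a) (hb : Regular b) (k : ℕ) :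
    partialJet k (a + b) = partialJet k a + partialJet k b := by
  funext q
  simp only [partialJet, restrict, jetDeriv, extend_add, Pi.add_apply]
  exact deriv_fun_add (ha.differentiable_jet q k) (hb.differentiable_jet q k)

lemma partialJet_mul {a b : JetSpace I → ℝ} (ha : Regular a) (hb : Regular b) (k : ℕ) :
    partialJet k (a * b) = a * partialJet k b + b * partialJet k a := by
  funext q
  simp only [partialJet, restrict, jetDeriv, extend_mul, Pi.add_apply, Pi.mul_apply]
  rw [deriv_fun_mul (ha.differentiable_jet q k) (hb.differentiable_jet q k)]
  simp only [Function.update_eq_self, extend_apply]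
  ring

lemma partialX_add {a b : JetSpace I → ℝ} (ha : Regular a) (hb : Regular b) :
    partialX (a + b) = partialX a + partialX b := by
  funext q
  simp only [partialX, restrict, extend_add, Pi.add_apply]
  exact deriv_fun_add (ha.differentiable_x q) (hb.differentiable_x q)

lemma partialX_mul {a b : JetSpace I → ℝ} (ha : Regular a) (hb : Regular b) :
    partialX (a * b) = a * partialX b + b * partialX a := by
  funext q
  simp only [partialX, restrict, extend_mul, Pi.add_apply, Pi.mul_apply]
  rw [deriv_fun_mul (ha.differentiable_x q) (hb.differentiable_x q)]
  simp only [extend_apply]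
  ring

lemma Regular.add {a b : JetSpace I → ℝ} (ha : Regular a) (hb : Regular b) : Regular (a + b) where
  differentiable_x q := by
    rw [extend_add]
    exact (ha.differentiable_x q).add (hb.differentiable_x q)
  differentiable_jet q k := by
    rw [extend_add]
    exact (ha.differentiable_jet q k).add (hb.differentiable_jet q k)
  finite_order := by
    obtain ⟨n, hn⟩ := ha.finite_order
    obtain ⟨m, hm⟩ := hb.finite_order
    refine ⟨max n m, fun k hk => ?_⟩
    rw [partialJet_add ha hb, hn k (le_of_max_le_left hk), hm k (le_of_max_le_right hk), add_zero]

lemma Regular.mul {a b : JetSpace I → ℝ} (ha : Regular a) (hb : Regular b) : Regular (a * b) where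
  differentiable_x q := by
    rw [extend_mul]
    exact (ha.differentiable_x q).mul (hb.differentiable_x q)
  differentiable_jet q k := by
    rw [extend_mul]
    exact (ha.differentiable_jet q k).mul (hb.differentiable_jet q k)
  finite_order := by
    obtain ⟨n, hn⟩ := ha.finite_order
    obtain ⟨m, hm⟩ := hb.finite_order
    refine ⟨max n m, fun k hk => ?_⟩
    rw [partialJet_mul ha hb, hn k (le_of_max_le_left hk), hm k (le_of_max_le_right hk)]
    simp

lemma total_eq_sum {a : JetSpace I → ℝ} {n : ℕ} (hn : ∀ k ≥ n, partialJet k a = 0)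
    (q : JetSpace I) :
    total a q = partialX a q + ∑ k ∈ Finset.range n, q.1.2.2 (k + 1) * partialJet k a q := by
  rw [total_apply, finsum_eq_sum_of_support_subset]
  intro k hk
  by_contra hkn
  simp only [Finset.coe_range, Set.mem_Iio, not_lt] at hkn
  simp [hn k hkn] at hk

lemma Regular.exists_common {a b : JetSpace I → ℝ} (ha : Regular a) (hb : Regular b) :
    ∃ n, (∀ k ≥ n, partialJet k a = 0) ∧ (∀ k ≥ n, partialJet k b = 0) := by
  obtain ⟨n, hn⟩ := ha.finite_order
  obtain ⟨m, hm⟩ := hb.finite_order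
  exact ⟨max n m, fun k hk => hn k (le_of_max_le_left hk), fun k hk => hm k (le_of_max_le_right hk)⟩

lemma total_add {a b : JetSpace I → ℝ} (ha : Regular a) (hb : Regular b) :
    total (a + b) = total a + total b := by
  obtain ⟨n, hn, hm⟩ := ha.exists_common hb
  have hs : ∀ k ≥ n, partialJet k (a + b) = 0 := fun k hk => by
    rw [partialJet_add ha hb, hn k hk, hm k hk, add_zero]
  funext q
  rw [Pi.add_apply, total_eq_sum hs, total_eq_sum hn, total_eq_sum hm, partialX_add ha hb]
  simp only [partialJet_add ha hb, Pi.add_apply, mul_add, Finset.sum_add_distrib]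
  ring

lemma total_mul {a b : JetSpace I → ℝ} (ha : Regular a) (hb : Regular b) :
    total (a * b) = a * total b + b * total a := by
  obtain ⟨n, hn, hm⟩ := ha.exists_common hb
  have hs : ∀ k ≥ n, partialJet k (a * b) = 0 := fun k hk => by
    rw [partialJet_mul ha hb, hn k hk, hm k hk]; simp
  funext q
  rw [Pi.add_apply, Pi.mul_apply, Pi.mul_apply, total_eq_sum hs, total_eq_sum hn, total_eq_sum hm,
    partialX_mul ha hb]
  simp only [partialJet_mul ha hb, Pi.add_apply, Pi.mul_apply, mul_add, Finset.mul_sum]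
  rw [add_add_add_comm (a q * _), ← Finset.sum_add_distrib]
  congr 1
  refine Finset.sum_congr rfl fun k _ => ?_
  ring

lemma regular_restrict {F : Density} (n : ℕ)
    (hx : ∀ q : JetSpace I, DifferentiableAt ℝ (fun y => F y q.1.2.1 q.1.2.2) q.1.1)
    (hj : ∀ (q : JetSpace I) (k : ℕ),
      DifferentiableAt ℝ (fun y => F q.1.1 q.1.2.1 (Function.update q.1.2.2 k y)) (q.1.2.2 k))
    (hn : ∀ k ≥ n, ∀ x t j y, F x t (Function.update j k y) = F x t j) :
    Regular (restrict I F) where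
  differentiable_x q := by
    rw [eq_of_restrict_eq (restrict_extend (restrict I F)) q]; exact hx q
  differentiable_jet q k :=
    (hj q k).congr_of_eventuallyEq (eventuallyEq_update (restrict_extend (restrict I F)) q k)
  finite_order := ⟨n, fun k hk => by
    rw [← restrict_jetDeriv]
    funext q
    simp [restrict, jetDeriv, hn k hk]⟩

/-- The coordinate function `x`. -/
def coordX (I : Opens ℝ) : JetSpace I → ℝ := restrict I fun x _ _ => x

/-- The coordinate function `t`. -/
def coordT (I : Opens ℝ) : JetSpace I → ℝ := restrict I fun _ t _ => t

/-- The jet coordinate `u^{(k)}`. -/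
def coordU (I : Opens ℝ) (k : ℕ) : JetSpace I → ℝ := restrict I fun _ _ j => j k

/-- The function `f(u)`. -/
def coefU (I : Opens ℝ) (f : ℝ → ℝ) : JetSpace I → ℝ := restrict I fun _ _ j => f (j 0)

lemma regular_const (r : ℝ) : Regular (algebraMap ℝ (JetSpace I → ℝ) r) :=
  regular_restrict (F := fun _ _ _ => r) 0 (by fun_prop) (by fun_prop) (by simp)

lemma regular_coordX : Regular (coordX I) :=
  regular_restrict 0 (by fun_prop) (by fun_prop) (by simp)

lemma regular_coordT : Regular (coordT I) :=
  regular_restrict 0 (by fun_prop) (by fun_prop) (by simp)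

lemma regular_coordU (m : ℕ) : Regular (coordU I m) := by
  refine regular_restrict (m + 1) (by fun_prop) (fun q k => ?_) ?_
  · rcases eq_or_ne m k with rfl | h
    · simp
    · simp [Function.update_of_ne h]
  · intro k hk x t j y
    rw [Function.update_of_ne (by omega)]

lemma regular_coefU {f : ℝ → ℝ} (hf : DifferentiableOn ℝ f I) : Regular (coefU I f) := by
  refine regular_restrict 1 (by fun_prop) (fun q k => ?_) ?_
  · rcases eq_or_ne 0 k with rfl | h
    · simpa using hf.differentiableAt (I.2.mem_nhds q.2)
    · simp [Function.update_of_ne h]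
  · intro k hk x t j y
    rw [Function.update_of_ne (by omega)]

lemma partialJet_const (k : ℕ) (r : ℝ) : partialJet k (algebraMap ℝ (JetSpace I → ℝ) r) = 0 := by
  change partialJet k (restrict I fun _ _ _ => r) = 0
  rw [← restrict_jetDeriv]
  funext q
  simp [restrict, jetDeriv]

lemma partialJet_coordX (k : ℕ) : partialJet k (coordX I) = 0 := by
  rw [coordX, ← restrict_jetDeriv]
  funext q
  simp [restrict, jetDeriv]

lemma partialJet_coordT (k : ℕ) : partialJet k (coordT I) = 0 := by
  rw [coordT, ← restrict_jetDeriv]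
  funext q
  simp [restrict, jetDeriv]

lemma partialJet_coordU (k m : ℕ) : partialJet k (coordU I m) = if k = m then 1 else 0 := by
  rw [coordU, ← restrict_jetDeriv]
  funext q
  split_ifs with h
  · subst h; simp [restrict, jetDeriv]
  · simp [restrict, jetDeriv, Function.update_of_ne (Ne.symm h)]

lemma partialJet_coefU (k : ℕ) (f : ℝ → ℝ) :
    partialJet k (coefU I f) = if k = 0 then coefU I (deriv f) else 0 := by
  rw [coefU, ← restrict_jetDeriv]
  funext q
  split_ifs with h
  · subst h; simp [restrict, jetDeriv, coefU]
  · simp [restrict, jetDeriv, Function.update_of_ne (Ne.symm h)]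

lemma total_const (r : ℝ) : total (algebraMap ℝ (JetSpace I → ℝ) r) = 0 := by
  funext q
  rw [total_eq_sum (n := 0) fun k _ => partialJet_const k r]
  simp only [Finset.range_zero, Finset.sum_empty, add_zero]
  exact (partialX_restrict (fun _ _ _ => r) q).trans (deriv_const _ r)

lemma total_coordX : total (coordX I) = 1 := by
  funext q
  rw [total_eq_sum (n := 0) fun k _ => partialJet_coordX k, coordX, partialX_restrict]
  simp

lemma total_coordT : total (coordT I) = 0 := by
  funext q
  rw [total_eq_sum (n := 0) fun k _ => partialJet_coordT k, coordT, partialX_restrict]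
  simp

lemma total_coordU (m : ℕ) : total (coordU I m) = coordU I (m + 1) := by
  funext q
  rw [total_eq_sum (n := m + 1) fun k hk => by rw [partialJet_coordU, if_neg (by omega)]]
  simp only [partialJet_coordU]
  rw [coordU, partialX_restrict, Finset.sum_eq_single m]
  · simp [coordU, restrict]
  · intro b _ hb; simp [hb]
  · simp

lemma total_coefU (f : ℝ → ℝ) : total (coefU I f) = coefU I (deriv f) * coordU I 1 := by
  funext q
  rw [total_eq_sum (n := 1) fun k hk => by rw [partialJet_coefU, if_neg (by omega)]]
  simp only [partialJet_coefU]
  rw [coefU, partialX_restrict]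
  simp [coordU, coefU, restrict, mul_comm]

end JetSpace

/-! ### The differential algebra of densities. -/

namespace JetSpace

variable {I : Opens ℝ}

/-- The functions smooth on `I`. -/
def smoothFun (I : Opens ℝ) : Subalgebra ℝ (ℝ → ℝ) where
  carrier := {f | ContDiffOn ℝ ∞ f I}
  mul_mem' hf hg := ContDiffOn.mul hf hg
  add_mem' hf hg := ContDiffOn.add hf hg
  algebraMap_mem' _ := contDiffOn_const

/-- The derivative of a function smooth on `I`. -/
def sderiv (f : smoothFun I) : smoothFun I :=
  ⟨deriv f, f.2.deriv_of_isOpen I.2 (by simp)⟩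

/-- The coordinate functions and the smooth functions of `u`. -/
def generators (I : Opens ℝ) : Set (JetSpace I → ℝ) :=
  {coordX I, coordT I} ∪ Set.range (coordU I) ∪ Set.range fun f : smoothFun I => coefU I f

/-- The algebra of the differential polynomials in `u`, with coefficients that are polynomial in
`x` and `t` and smooth in `u ∈ I`. -/
def jetAlgebra (I : Opens ℝ) : Subalgebra ℝ (JetSpace I → ℝ) := Algebra.adjoin ℝ (generators I)

lemma coordX_mem : coordX I ∈ jetAlgebra I := Algebra.subset_adjoin (by simp [generators])

lemma coordT_mem : coordT I ∈ jetAlgebra I := Algebra.subset_adjoin (by simp [generators])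

lemma coordU_mem (k : ℕ) : coordU I k ∈ jetAlgebra I :=
  Algebra.subset_adjoin (Or.inl (Or.inr ⟨k, rfl⟩))

lemma coefU_mem (f : smoothFun I) : coefU I f ∈ jetAlgebra I :=
  Algebra.subset_adjoin (Or.inr ⟨f, rfl⟩)

lemma jetAlgebra_induction {p : (JetSpace I → ℝ) → Prop} (hx : p (coordX I)) (ht : p (coordT I))
    (hu : ∀ k, p (coordU I k)) (hf : ∀ f : smoothFun I, p (coefU I f))
    (hr : ∀ r : ℝ, p (algebraMap ℝ (JetSpace I → ℝ) r))
    (hadd : ∀ a b, a ∈ jetAlgebra I → b ∈ jetAlgebra I → p a → p b → p (a + b))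
    (hmul : ∀ a b, a ∈ jetAlgebra I → b ∈ jetAlgebra I → p a → p b → p (a * b))
    {a : JetSpace I → ℝ} (ha : a ∈ jetAlgebra I) : p a := by
  induction ha using Algebra.adjoin_induction with
  | mem a ha =>
    rcases ha with ((rfl | rfl) | ⟨k, rfl⟩) | ⟨f, rfl⟩
    exacts [hx, ht, hu k, hf f]
  | algebraMap r => exact hr r
  | add a b ha hb pa pb => exact hadd a b ha hb pa pb
  | mul a b ha hb pa pb => exact hmul a b ha hb pa pb

lemma regular_of_mem {a : JetSpace I → ℝ} (ha : a ∈ jetAlgebra I) : Regular a :=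
  jetAlgebra_induction regular_coordX regular_coordT regular_coordU
    (fun f => regular_coefU (f.2.differentiableOn (by simp))) regular_const
    (fun _ _ _ _ => Regular.add) (fun _ _ _ _ => Regular.mul) ha

lemma partialJet_mem {a : JetSpace I → ℝ} (ha : a ∈ jetAlgebra I) (k : ℕ) :
    partialJet k a ∈ jetAlgebra I := by
  refine jetAlgebra_induction (p := fun a => partialJet k a ∈ jetAlgebra I) ?_ ?_ (fun m => ?_) (fun f => ?_) (fun r => ?_)
    (fun a b ha hb pa pb => ?_) (fun a b ha hb pa pb => ?_) ha
  · simp [partialJet_coordX, zero_mem]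
  · simp [partialJet_coordT, zero_mem]
  · rw [partialJet_coordU]; split_ifs
    exacts [one_mem _, zero_mem _]
  · rw [partialJet_coefU]; split_ifs
    exacts [coefU_mem (sderiv f), zero_mem _]
  · simp [partialJet_const, zero_mem]
  · rw [partialJet_add (regular_of_mem ha) (regular_of_mem hb)]
    exact add_mem pa pb
  · rw [partialJet_mul (regular_of_mem ha) (regular_of_mem hb)]
    exact add_mem (mul_mem ha pb) (mul_mem hb pa)

lemma total_mem {a : JetSpace I → ℝ} (ha : a ∈ jetAlgebra I) : total a ∈ jetAlgebra I := by
  refine jetAlgebra_induction (p := fun a => total a ∈ jetAlgebra I) ?_ ?_ (fun m => ?_) (fun f => ?_) (fun r => ?_)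
    (fun a b ha hb pa pb => ?_) (fun a b ha hb pa pb => ?_) ha
  · simp [total_coordX, one_mem]
  · simp [total_coordT, zero_mem]
  · rw [total_coordU]; exact coordU_mem _
  · rw [total_coefU]; exact mul_mem (coefU_mem (sderiv f)) (coordU_mem 1)
  · simp [total_const, zero_mem]
  · rw [total_add (regular_of_mem ha) (regular_of_mem hb)]
    exact add_mem pa pb
  · rw [total_mul (regular_of_mem ha) (regular_of_mem hb)]
    exact add_mem (mul_mem ha pb) (mul_mem hb pa)

/-- `∂/∂u^{(k)}` as a derivation. -/
def pd (k : ℕ) : Derivation ℝ (jetAlgebra I) (jetAlgebra I) :=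
  Derivation.mk'
    { toFun := fun a => ⟨partialJet k a, partialJet_mem a.2 k⟩
      map_add' := fun a b =>
        Subtype.ext (partialJet_add (regular_of_mem a.2) (regular_of_mem b.2) k)
      map_smul' := fun r a => Subtype.ext (by
        have h := partialJet_mul (regular_const r) (regular_of_mem a.2) k
        rw [partialJet_const, mul_zero, add_zero] at h
        simpa [Algebra.smul_def] using h) }
    fun a b => Subtype.ext (partialJet_mul (regular_of_mem a.2) (regular_of_mem b.2) k)

/-- The total derivative `d/dx` as a derivation. -/
def td : Derivation ℝ (jetAlgebra I) (jetAlgebra I) :=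
  Derivation.mk'
    { toFun := fun a => ⟨total a, total_mem a.2⟩
      map_add' := fun a b =>
        Subtype.ext (total_add (regular_of_mem a.2) (regular_of_mem b.2))
      map_smul' := fun r a => Subtype.ext (by
        have h := total_mul (regular_const r) (regular_of_mem a.2)
        rw [total_const, mul_zero, add_zero] at h
        simpa [Algebra.smul_def] using h) }
    fun a b => Subtype.ext (total_mul (regular_of_mem a.2) (regular_of_mem b.2))

@[simp] lemma pd_coe (k : ℕ) (a : jetAlgebra I) :
    (pd k a : JetSpace I → ℝ) = partialJet k (a : JetSpace I → ℝ) := rfl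

/-- The variable `x`. -/
def jx : jetAlgebra I := ⟨coordX I, coordX_mem⟩

/-- The variable `t`. -/
def jt : jetAlgebra I := ⟨coordT I, coordT_mem⟩

/-- The jet coordinate `u^{(k)}`. -/
def ju (k : ℕ) : jetAlgebra I := ⟨coordU I k, coordU_mem k⟩

/-- The function `f(u)`. -/
def jf : smoothFun I →ₐ[ℝ] jetAlgebra I where
  toFun f := ⟨coefU I f, coefU_mem f⟩
  map_one' := rfl
  map_mul' _ _ := rfl
  map_zero' := rfl
  map_add' _ _ := rfl
  commutes' _ := rfl

/-- Evaluation at a jet. -/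
def ev (q : JetSpace I) : jetAlgebra I →ₐ[ℝ] ℝ := (Pi.evalAlgHom ℝ _ q).comp (jetAlgebra I).val

lemma ev_apply (q : JetSpace I) (a : jetAlgebra I) : ev q a = a.1 q := rfl

@[simp] lemma ev_jx (q : JetSpace I) : ev q jx = q.1.1 := rfl
@[simp] lemma ev_jt (q : JetSpace I) : ev q jt = q.1.2.1 := rfl
@[simp] lemma ev_ju (k : ℕ) (q : JetSpace I) : ev q (ju k) = q.1.2.2 k := rfl
@[simp] lemma ev_jf (f : smoothFun I) (q : JetSpace I) : ev q (jf f) = f.1 (q.1.2.2 0) := rfl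

@[simp] lemma ev_ofNat (n : ℕ) [n.AtLeastTwo] (q : JetSpace I) :
    ev q (no_index (OfNat.ofNat n : jetAlgebra I)) = OfNat.ofNat n := map_ofNat _ n

lemma eq_zero_of_ev {a : jetAlgebra I} (h : ∀ q, ev q a = 0) : a = 0 := Subtype.ext (funext h)

@[simp] lemma pd_jx (k : ℕ) : pd k (jx : jetAlgebra I) = 0 := Subtype.ext (partialJet_coordX k)
@[simp] lemma pd_jt (k : ℕ) : pd k (jt : jetAlgebra I) = 0 := Subtype.ext (partialJet_coordT k)
@[simp] lemma pd_ju (k m : ℕ) : pd k (ju m : jetAlgebra I) = if k = m then 1 else 0 :=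
  Subtype.ext (by rw [pd_coe, ju, partialJet_coordU]; split_ifs <;> rfl)

lemma pd_jf (k : ℕ) (f : smoothFun I) : pd k (jf f) = if k = 0 then jf (sderiv f) else 0 :=
  Subtype.ext ((partialJet_coefU k f).trans (by split_ifs <;> rfl))
lemma pd_zero_jf (f : smoothFun I) : pd 0 (jf f) = jf (sderiv f) := by simp [pd_jf]
@[simp] lemma pd_succ_jf (k : ℕ) (f : smoothFun I) : pd (k + 1) (jf f) = 0 := by simp [pd_jf]

@[simp] lemma td_jx : td (jx : jetAlgebra I) = 1 := Subtype.ext total_coordX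
@[simp] lemma td_jt : td (jt : jetAlgebra I) = 0 := Subtype.ext total_coordT
@[simp] lemma td_ju (m : ℕ) : td (ju m : jetAlgebra I) = ju (m + 1) := Subtype.ext (total_coordU m)
lemma td_jf (f : smoothFun I) : td (jf f) = jf (sderiv f) * ju 1 :=
  Subtype.ext (total_coefU f)

lemma jets_induction {p : jetAlgebra I → Prop} (hx : p jx) (ht : p jt) (hu : ∀ k, p (ju k))
    (hf : ∀ f, p (jf f)) (hr : ∀ r : ℝ, p (algebraMap ℝ _ r))
    (hadd : ∀ a b, p a → p b → p (a + b)) (hmul : ∀ a b, p a → p b → p (a * b))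
    (a : jetAlgebra I) : p a := by
  have key : ∃ h : a.1 ∈ jetAlgebra I, p ⟨a.1, h⟩ :=
    jetAlgebra_induction (p := fun a => ∃ h : a ∈ jetAlgebra I, p ⟨a, h⟩)
      ⟨_, hx⟩ ⟨_, ht⟩ (fun k => ⟨_, hu k⟩) (fun f => ⟨_, hf f⟩) (fun r => ⟨_, hr r⟩)
      (fun _ _ _ _ ⟨_, pa⟩ ⟨_, pb⟩ => ⟨_, hadd _ _ pa pb⟩)
      (fun _ _ _ _ ⟨_, pa⟩ ⟨_, pb⟩ => ⟨_, hmul _ _ pa pb⟩) a.2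
  exact key.2

lemma exists_order (a : jetAlgebra I) : ∃ n, ∀ k ≥ n, pd k a = 0 := by
  obtain ⟨n, hn⟩ := (regular_of_mem a.2).finite_order
  exact ⟨n, fun k hk => Subtype.ext (hn k hk)⟩

lemma pd_zero_td (a : jetAlgebra I) : pd 0 (td a) = td (pd 0 a) := by
  refine jets_induction (p := fun a => pd 0 (td a) = td (pd 0 a)) ?_ ?_ (fun k => ?_)
    (fun f => ?_) (fun r => ?_) (fun a b ha hb => ?_) (fun a b ha hb => ?_) a
  · simp
  · simp
  · rcases eq_or_ne 0 k with rfl | hk <;> simp [*]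
  · simp [td_jf, pd_zero_jf, mul_comm]
  · simp
  · simp [ha, hb]
  · simp only [Derivation.leibniz, map_add, ha, hb, smul_eq_mul]
    ring

/-- The commutator of two derivations is a derivation, so it is determined by the generators, where
`td (ju m) = ju (m + 1)` is what counts. This commutator makes the Euler–Lagrange sum of a total
derivative telescope. -/
lemma pd_succ_td (k : ℕ) (a : jetAlgebra I) :
    pd (k + 1) (td a) = td (pd (k + 1) a) + pd k a := by
  refine jets_induction (p := fun a => pd (k + 1) (td a) = td (pd (k + 1) a) + pd k a) ?_ ?_
    (fun m => ?_) (fun f => ?_) (fun r => ?_) (fun a b ha hb => ?_) (fun a b ha hb => ?_) a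
  · simp
  · simp
  · have h1 : td (if k + 1 = m then (1 : jetAlgebra I) else 0) = 0 := by split_ifs <;> simp
    simp [h1]
  · rcases k with _ | k <;> simp [td_jf, pd_zero_jf]
  · simp
  · simp only [map_add, ha, hb]; abel
  · simp only [Derivation.leibniz, map_add, ha, hb, smul_eq_mul]
    ring

end JetSpace

/-! ### The Euler–Lagrange operator on the differential algebra. -/

namespace JetSpace

variable {I : Opens ℝ}

lemma iterate_td_add (k : ℕ) (a b : jetAlgebra I) : td^[k] (a + b) = td^[k] a + td^[k] b :=
  iterate_map_add td k a b

lemma iterate_td_zero (k : ℕ) : td^[k] (0 : jetAlgebra I) = 0 := iterate_map_zero td k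

lemma iterate_td_smul (k : ℕ) (r : ℝ) (a : jetAlgebra I) : td^[k] (r • a) = r • td^[k] a := by
  induction k with
  | zero => rfl
  | succ k ih => simp only [Function.iterate_succ_apply', ih, Derivation.map_smul]

lemma finsum_euler_eq_sum {a : jetAlgebra I} {n : ℕ} (hn : ∀ k ≥ n, pd k a = 0) :
    ∑ᶠ k : ℕ, (-1 : ℝ) ^ k • td^[k] (pd k a) =
      ∑ k ∈ Finset.range n, (-1 : ℝ) ^ k • td^[k] (pd k a) := by
  refine finsum_eq_sum_of_support_subset _ fun k hk => ?_
  by_contra hkn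
  simp only [Finset.coe_range, Set.mem_Iio, not_lt] at hkn
  simp [hn k hkn] at hk

lemma exists_common_order (a b : jetAlgebra I) :
    ∃ n, (∀ k ≥ n, pd k a = 0) ∧ (∀ k ≥ n, pd k b = 0) := by
  obtain ⟨n, hn⟩ := exists_order a
  obtain ⟨m, hm⟩ := exists_order b
  exact ⟨max n m, fun k hk => hn k (le_of_max_le_left hk), fun k hk => hm k (le_of_max_le_right hk)⟩

/-- The Euler-Lagrange operator on differential polynomials. -/
def el : jetAlgebra I →ₗ[ℝ] jetAlgebra I where
  toFun a := ∑ᶠ k : ℕ, (-1 : ℝ) ^ k • td^[k] (pd k a)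
  map_add' a b := by
    obtain ⟨n, ha, hb⟩ := exists_common_order a b
    rw [finsum_euler_eq_sum ha, finsum_euler_eq_sum hb, finsum_euler_eq_sum (n := n)
      fun k hk => by rw [map_add, ha k hk, hb k hk, add_zero], ← Finset.sum_add_distrib]
    refine Finset.sum_congr rfl fun k _ => ?_
    rw [map_add, iterate_td_add, smul_add]
  map_smul' r a := by
    obtain ⟨n, hn⟩ := exists_order a
    rw [finsum_euler_eq_sum hn, finsum_euler_eq_sum (n := n)
      fun k hk => by rw [Derivation.map_smul, hn k hk, smul_zero], RingHom.id_apply,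
      Finset.smul_sum]
    refine Finset.sum_congr rfl fun k _ => ?_
    rw [Derivation.map_smul, iterate_td_smul, smul_comm]

lemma el_eq_sum {a : jetAlgebra I} {n : ℕ} (hn : ∀ k ≥ n, pd k a = 0) :
    el a = ∑ k ∈ Finset.range n, (-1 : ℝ) ^ k • td^[k] (pd k a) := finsum_euler_eq_sum hn

/-- The Euler-Lagrange operator of a density of second order. -/
lemma el_eq_of_order_two {a : jetAlgebra I} (ha : ∀ k, pd (k + 3) a = 0) :
    el a = pd 0 a - td (pd 1 a) + td (td (pd 2 a)) := by
  rw [el_eq_sum (n := 3) fun k hk => by obtain ⟨m, rfl⟩ := Nat.exists_eq_add_of_le' hk; exact ha m]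
  simp [Finset.sum_range_succ, sub_eq_add_neg]

/-- The Euler-Lagrange operator annihilates total derivatives. -/
lemma el_td (a : jetAlgebra I) : el (td a) = 0 := by
  obtain ⟨n, hn⟩ := exists_order a
  have htd : ∀ k ≥ n + 1, pd k (td a) = 0 := fun k hk => by
    obtain ⟨m, rfl⟩ := Nat.exists_eq_add_of_le' (Nat.le_of_add_left_le hk : 1 ≤ k)
    rw [pd_succ_td, hn m (by omega), hn (m + 1) (by omega), map_zero, add_zero]
  -- The sum telescopes by `pd_succ_td`, leaving one boundary term; it vanishes once `m` reaches a
  -- bound for the order of `a`.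
  have key : ∀ m, ∑ k ∈ Finset.range (m + 1), (-1 : ℝ) ^ k • td^[k] (pd k (td a)) =
      (-1 : ℝ) ^ m • td^[m + 1] (pd m a) := fun m => by
    induction m with
    | zero => simp [pd_zero_td]
    | succ m ih =>
      rw [Finset.sum_range_succ, ih, pd_succ_td, iterate_td_add, Function.iterate_succ_apply td,
        Function.iterate_succ_apply td (m + 1), smul_add, pow_succ]
      simp only [mul_neg, mul_one, neg_smul, Function.iterate_succ_apply]
      abel
  rw [el_eq_sum htd, key, hn n le_rfl, iterate_td_zero, smul_zero]

lemma restrict_iterate_totalDeriv {F : Density} {a : jetAlgebra I} (h : restrict I F = a) (k : ℕ) :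
    restrict I (totalDeriv^[k] F) = (td^[k] a : jetAlgebra I) := by
  induction k with
  | zero => exact h
  | succ k ih =>
    rw [Function.iterate_succ_apply', Function.iterate_succ_apply', restrict_totalDeriv, ih]
    rfl

/-- `el` is the restriction of `euler`. -/
lemma restrict_euler {F : Density} {a : jetAlgebra I} (h : restrict I F = a) :
    restrict I (euler F) = el a := by
  obtain ⟨n, hn⟩ := exists_order a
  have hk : ∀ k, restrict I (totalDeriv^[k] (jetDeriv k F)) = (td^[k] (pd k a) : jetAlgebra I) :=
    fun k => restrict_iterate_totalDeriv (by rw [restrict_jetDeriv, h]; rfl) k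
  funext q
  have hq : ∀ k, totalDeriv^[k] (jetDeriv k F) q.1.1 q.1.2.1 q.1.2.2 =
      (td^[k] (pd k a) : jetAlgebra I).1 q := fun k => congrFun (hk k) q
  rw [el_eq_sum hn]
  simp only [restrict, euler, hq]
  rw [finsum_eq_sum_of_support_subset (s := Finset.range n)]
  · simp
  · intro k hk
    by_contra hkn
    simp only [Finset.coe_range, Set.mem_Iio, not_lt] at hkn
    simp [hn k hkn] at hk

end JetSpace

/-! ### Integration by parts of the bracket density. -/

namespace JetSpace

lemma derivation_ofNat {A : Type*} [CommRing A] [Algebra ℝ A] (D : Derivation ℝ A A) (n : ℕ)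
    [n.AtLeastTwo] : D (no_index (OfNat.ofNat n : A)) = 0 := D.map_natCast n

/-- Counting `x`-derivatives, the terms with `x` or `t` have weight 3 and the others weight 2;
modulo total derivatives such terms reduce to multiples of `u_x³` and `u_x²`. The argument of the
last `D` is an explicit antiderivative. Here `a0 n` plays the role of the `n`-th derivative of a
function of `u`, so the chain rule is the only property needed. -/
lemma bracket_order_two {A : Type*} [CommRing A] [Algebra ℝ A] (D : Derivation ℝ A A)
    {x t : A} {u a0 a1 b0 b1 h0 h1 : ℕ → A} (hx : D x = 1) (ht : D t = 0)
    (hu : ∀ n, D (u n) = u (n + 1))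
    (ha0 : ∀ n, D (a0 n) = a0 (n + 1) * u 1) (ha1 : ∀ n, D (a1 n) = a1 (n + 1) * u 1)
    (hb0 : ∀ n, D (b0 n) = b0 (n + 1) * u 1) (hb1 : ∀ n, D (b1 n) = b1 (n + 1) * u 1)
    (hh0 : ∀ n, D (h0 n) = h0 (n + 1) * u 1) (hh1 : ∀ n, D (h1 n) = h1 (n + 1) * u 1) :
    b1 0 * u 1 ^ 2 + (a0 1 * x + b0 1 * t) * D (-2 * h1 0 * u 2 - h1 1 * u 1 ^ 2)
      + (-2 * a1 0 * u 1 - 2 * a1 0 * u 2 * x - a1 1 * u 1 ^ 2 * x - 2 * b1 0 * u 2 * t - b1 1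
        * u 1 ^ 2 * t) * D (h0 1) =
      (-a0 1 * h1 1 - 3 * a0 2 * h1 0 - a1 0 * h0 2 + b1 0) * u 1 ^ 2
      + x * ((-a0 3 * h1 0 + a1 0 * h0 3) * u 1 ^ 3)
      + t * ((-b0 3 * h1 0 + b1 0 * h0 3) * u 1 ^ 3)
      + D (2 * a0 1 * h1 0 * u 1 - 2 * a0 1 * h1 0 * u 2 * x - a0 1 * h1 1 * u 1 ^ 2 * x + a0 2 *
        h1 0 * u 1 ^ 2 * x - a1 0 * h0 2 * u 1 ^ 2 * x - 2 * b0 1 * h1 0 * u 2 * t - b0 1 *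
        h1 1 * u 1 ^ 2 * t + b0 2 * h1 0 * u 1 ^ 2 * t - b1 0 * h0 2 * u 1 ^ 2 * t) := by
  simp only [map_add, map_sub, map_neg, Derivation.leibniz, Derivation.leibniz_pow, hx, ht, hu, ha0,
    ha1, hb0, hb1, hh0, hh1, derivation_ofNat, smul_eq_mul, nsmul_eq_mul, Nat.cast_ofNat,
    Nat.reduceAdd, Nat.reduceSub]
  ring

/-- The same reduction in weights 5 and 4, where `u_x u_xx²`, `u_x⁵` and `u_xx²`, `u_x⁴` remain
modulo total derivatives. The factor 6 clears the denominators produced by integrating by parts. -/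
lemma bracket_order_four {A : Type*} [CommRing A] [Algebra ℝ A] (D : Derivation ℝ A A)
    {x t : A} {u a0 a1 a2 a3 b0 b1 b2 b3 h0 h1 h2 h3 e : ℕ → A} (hx : D x = 1) (ht : D t = 0)
    (hu : ∀ n, D (u n) = u (n + 1))
    (ha0 : ∀ n, D (a0 n) = a0 (n + 1) * u 1) (ha1 : ∀ n, D (a1 n) = a1 (n + 1) * u 1)
    (ha2 : ∀ n, D (a2 n) = a2 (n + 1) * u 1) (ha3 : ∀ n, D (a3 n) = a3 (n + 1) * u 1)
    (hb0 : ∀ n, D (b0 n) = b0 (n + 1) * u 1) (hb1 : ∀ n, D (b1 n) = b1 (n + 1) * u 1)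
    (hb2 : ∀ n, D (b2 n) = b2 (n + 1) * u 1) (hb3 : ∀ n, D (b3 n) = b3 (n + 1) * u 1)
    (hh0 : ∀ n, D (h0 n) = h0 (n + 1) * u 1) (hh1 : ∀ n, D (h1 n) = h1 (n + 1) * u 1)
    (hh2 : ∀ n, D (h2 n) = h2 (n + 1) * u 1) (hh3 : ∀ n, D (h3 n) = h3 (n + 1) * u 1)
    (he : ∀ n, D (e n) = e (n + 1) * u 1) :
    6 * (b2 0 * u 1 ^ 4 + b3 0 * u 2 ^ 2
      + (a0 1 * x + b0 1 * t) * D (-12 * h2 0 * u 1 ^ 2 * u 2 - 3 * h2 1 * u 1 ^ 4 + 2 * h3 0 * u 4 + 4 * h3 1 * u 1 *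
        u 3 + 3 * h3 1 * u 2 ^ 2 + 2 * h3 2 * u 1 ^ 2 * u 2)
      + (-2 * a1 0 * u 1 - 2 * a1 0 * u 2 * x - a1 1 * u 1 ^ 2 * x - 2 * b1 0 * u 2 * t - b1 1
        * u 1 ^ 2 * t) *
        D (-2 * h1 0 * u 2 - h1 1 * u 1 ^ 2)
      + (-12 * a2 0 * u 1 ^ 2 * u 2 * x - 4 * a2 0 * u 1 ^ 3 - 3 * a2 1 * u 1 ^ 4 * x + 4 *
        a3 0 * u 3 + 2 * a3 0 * u 4 * x + 4 * a3 1 * u 1 * u 2 + 4 * a3 1 * u 1 * u 3 * x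
        + 3 * a3 1 * u 2 ^ 2 * x + 2 * a3 2 * u 1 ^ 2 * u 2 * x - 12 * b2 0 * u 1 ^ 2 * u 2
        * t - 3 * b2 1 * u 1 ^ 4 * t + 2 * b3 0 * u 4 * t + 4 * b3 1 * u 1 * u 3 * t + 3 *
        b3 1 * u 2 ^ 2 * t + 2 * b3 2 * u 1 ^ 2 * u 2 * t - 6 * e 0 * u 1 * u 2 - 2 * e 1 *
        u 1 ^ 3) * D (h0 1)) =
      (-6 * a0 1 * h3 1 - 30 * a0 2 * h3 0 - 36 * a1 0 * h1 0 - 6 * a3 0 * h0 2 + 6 * b3 0) * u 2 ^ 2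
      + (-6 * a0 1 * h2 1 - 42 * a0 2 * h2 0 + 12 * a0 3 * h3 1 + 15 * a0 4 * h3 0 + a1 0 *
        h1 2 + a1 1 * h1 1 + 15 * a1 2 * h1 0 - 6 * a2 0 * h0 2 - 3 * a3 0 * h0 4 + 6 * b2 0
        + 12 * e 0 * h0 3) * u 1 ^ 4
      + x * ((-30 * a0 3 * h3 0 + 36 * a1 0 * h1 1 - 36 * a1 1 * h1 0 + 30 * a3 0 * h0 3) * (u 1 * u 2 ^ 2)
        + (-18 * a0 3 * h2 0 + 3 * a0 4 * h3 1 + 3 * a0 5 * h3 0 - 3 * a1 0 * h1 3 + 3 * a1 3 *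
        h1 0 + 18 * a2 0 * h0 3 - 3 * a3 0 * h0 5 - 3 * a3 1 * h0 4) * u 1 ^ 5)
      + t * ((-30 * b0 3 * h3 0 + 36 * b1 0 * h1 1 - 36 * b1 1 * h1 0 + 30 * b3 0 * h0 3) * (u 1 * u 2 ^ 2)
        + (-18 * b0 3 * h2 0 + 3 * b0 4 * h3 1 + 3 * b0 5 * h3 0 - 3 * b1 0 * h1 3 + 3 * b1 3 *
        h1 0 + 18 * b2 0 * h0 3 - 3 * b3 0 * h0 5 - 3 * b3 1 * h0 4) * u 1 ^ 5)
      + D (-72 * a0 1 * h2 0 * u 1 ^ 2 * u 2 * x + 24 * a0 1 * h2 0 * u 1 ^ 3 - 18 * a0 1 * h2 1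
        * u 1 ^ 4 * x - 12 * a0 1 * h3 0 * u 3 + 12 * a0 1 * h3 0 * u 4 * x - 12 * a0 1 *
        h3 1 * u 1 * u 2 + 24 * a0 1 * h3 1 * u 1 * u 3 * x + 18 * a0 1 * h3 1 * u 2 ^ 2 * x
        + 12 * a0 1 * h3 2 * u 1 ^ 2 * u 2 * x + 18 * a0 2 * h2 0 * u 1 ^ 4 * x + 24 * a0 2
        * h3 0 * u 1 * u 2 - 12 * a0 2 * h3 0 * u 1 * u 3 * x + 6 * a0 2 * h3 0 * u 2 ^ 2 *
        x - 12 * a0 2 * h3 1 * u 1 ^ 2 * u 2 * x + 12 * a0 3 * h3 0 * u 1 ^ 2 * u 2 * x - 12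
        * a0 3 * h3 0 * u 1 ^ 3 - 3 * a0 4 * h3 0 * u 1 ^ 4 * x + 24 * a1 0 * h1 0 * u 1 *
        u 2 + 12 * a1 0 * h1 0 * u 2 ^ 2 * x + 8 * a1 0 * h1 1 * u 1 ^ 3 + 3 * a1 0 * h1 2 *
        u 1 ^ 4 * x + 12 * a1 1 * h1 0 * u 1 ^ 2 * u 2 * x - 12 * a1 1 * h1 0 * u 1 ^ 3 + 3
        * a1 1 * h1 1 * u 1 ^ 4 * x - 3 * a1 2 * h1 0 * u 1 ^ 4 * x - 18 * a2 0 * h0 2 *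
        u 1 ^ 4 * x + 12 * a3 0 * h0 2 * u 1 * u 2 + 12 * a3 0 * h0 2 * u 1 * u 3 * x - 6 *
        a3 0 * h0 2 * u 2 ^ 2 * x - 12 * a3 0 * h0 3 * u 1 ^ 2 * u 2 * x + 3 * a3 0 * h0 4 *
        u 1 ^ 4 * x + 12 * a3 1 * h0 2 * u 1 ^ 2 * u 2 * x - 72 * b0 1 * h2 0 * u 1 ^ 2 *
        u 2 * t - 18 * b0 1 * h2 1 * u 1 ^ 4 * t + 12 * b0 1 * h3 0 * u 4 * t + 24 * b0 1 *
        h3 1 * u 1 * u 3 * t + 18 * b0 1 * h3 1 * u 2 ^ 2 * t + 12 * b0 1 * h3 2 * u 1 ^ 2 *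
        u 2 * t + 18 * b0 2 * h2 0 * u 1 ^ 4 * t - 12 * b0 2 * h3 0 * u 1 * u 3 * t + 6 *
        b0 2 * h3 0 * u 2 ^ 2 * t - 12 * b0 2 * h3 1 * u 1 ^ 2 * u 2 * t + 12 * b0 3 * h3 0
        * u 1 ^ 2 * u 2 * t - 3 * b0 4 * h3 0 * u 1 ^ 4 * t + 12 * b1 0 * h1 0 * u 2 ^ 2 * t
        + 3 * b1 0 * h1 2 * u 1 ^ 4 * t + 12 * b1 1 * h1 0 * u 1 ^ 2 * u 2 * t + 3 * b1 1 *
        h1 1 * u 1 ^ 4 * t - 3 * b1 2 * h1 0 * u 1 ^ 4 * t - 18 * b2 0 * h0 2 * u 1 ^ 4 * t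
        + 12 * b3 0 * h0 2 * u 1 * u 3 * t - 6 * b3 0 * h0 2 * u 2 ^ 2 * t - 12 * b3 0 *
        h0 3 * u 1 ^ 2 * u 2 * t + 3 * b3 0 * h0 4 * u 1 ^ 4 * t + 12 * b3 1 * h0 2 *
        u 1 ^ 2 * u 2 * t - 12 * e 0 * h0 2 * u 1 ^ 3) := by
  simp only [map_add, map_sub, map_neg, Derivation.leibniz, Derivation.leibniz_pow, hx, ht, hu, ha0,
    ha1, ha2, ha3, hb0, hb1, hb2, hb3, hh0, hh1, hh2, hh3, he, derivation_ofNat, smul_eq_mul,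
    nsmul_eq_mul, Nat.cast_ofNat, Nat.reduceAdd, Nat.reduceSub]
  ring

end JetSpace

/-! ### Explicit variational derivatives. -/

namespace JetSpace

variable {I : Opens ℝ}

/-- The `n`-th derivative of a function smooth on `I`. -/
def sd (n : ℕ) (f : smoothFun I) : smoothFun I :=
  ⟨iteratedDeriv n f, by
    induction n with
    | zero => rw [iteratedDeriv_zero]; exact f.2
    | succ n ih => rw [iteratedDeriv_succ]; exact (sderiv ⟨_, ih⟩).2⟩

@[simp] lemma sd_coe (n : ℕ) (f : smoothFun I) : (sd n f : ℝ → ℝ) = iteratedDeriv n f := rfl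

lemma sd_zero (f : smoothFun I) : sd 0 f = f := Subtype.ext iteratedDeriv_zero

lemma sderiv_sd (n : ℕ) (f : smoothFun I) : sderiv (sd n f) = sd (n + 1) f :=
  Subtype.ext iteratedDeriv_succ.symm

lemma td_sd (n : ℕ) (f : smoothFun I) : td (jf (sd n f)) = jf (sd (n + 1) f) * ju 1 := by
  rw [td_jf, sderiv_sd]

lemma pd_zero_sd (n : ℕ) (f : smoothFun I) : pd 0 (jf (sd n f)) = jf (sd (n + 1) f) := by
  rw [pd_zero_jf, sderiv_sd]

lemma el_string_zero (a0 b0 : smoothFun I) :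
    el (jx * jf (sd 0 a0) + jt * jf (sd 0 b0)) = jf (sd 1 a0) * jx + jf (sd 1 b0) * jt := by
  rw [el_eq_of_order_two fun k => by simp [Derivation.leibniz]]
  simp [Derivation.leibniz, pd_zero_sd]
  ring

lemma el_string_two (a1 b1 : smoothFun I) :
    el (jx * (jf (sd 0 a1) * ju 1 ^ 2) + jt * (jf (sd 0 b1) * ju 1 ^ 2)) =
    -2 * jf (sd 0 a1) * ju 1 - 2 * jf (sd 0 a1) * ju 2 * jx - jf (sd 1 a1) * ju 1 ^ 2 * jx - 2 *
      jf (sd 0 b1) * ju 2 * jt - jf (sd 1 b1) * ju 1 ^ 2 * jt := by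
  rw [el_eq_of_order_two fun k => by simp [Derivation.leibniz, Derivation.leibniz_pow]]
  simp [Derivation.leibniz, Derivation.leibniz_pow, derivation_ofNat, pd_zero_sd, td_sd]
  ring

lemma el_string_four (a2 a3 b2 b3 e : smoothFun I) :
    el (jx * (jf (sd 0 a2) * ju 1 ^ 4 + jf (sd 0 a3) * ju 2 ^ 2) + jf (sd 0 e) * ju 1 ^ 3
      + jt * (jf (sd 0 b2) * ju 1 ^ 4 + jf (sd 0 b3) * ju 2 ^ 2)) =
    -12 * jf (sd 0 a2) * ju 1 ^ 2 * ju 2 * jx - 4 * jf (sd 0 a2) * ju 1 ^ 3 - 3 * jf (sd 1 a2) *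
      ju 1 ^ 4 * jx + 4 * jf (sd 0 a3) * ju 3 + 2 * jf (sd 0 a3) * ju 4 * jx + 4 *
      jf (sd 1 a3) * ju 1 * ju 2 + 4 * jf (sd 1 a3) * ju 1 * ju 3 * jx + 3 * jf (sd 1 a3) *
      ju 2 ^ 2 * jx + 2 * jf (sd 2 a3) * ju 1 ^ 2 * ju 2 * jx - 12 * jf (sd 0 b2) * ju 1 ^ 2
      * ju 2 * jt - 3 * jf (sd 1 b2) * ju 1 ^ 4 * jt + 2 * jf (sd 0 b3) * ju 4 * jt + 4 *
      jf (sd 1 b3) * ju 1 * ju 3 * jt + 3 * jf (sd 1 b3) * ju 2 ^ 2 * jt + 2 * jf (sd 2 b3)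
      * ju 1 ^ 2 * ju 2 * jt - 6 * jf (sd 0 e) * ju 1 * ju 2 - 2 * jf (sd 1 e) * ju 1 ^ 3 := by
  rw [el_eq_of_order_two fun k => by simp [Derivation.leibniz, Derivation.leibniz_pow]]
  simp [Derivation.leibniz, Derivation.leibniz_pow, derivation_ofNat, pd_zero_sd, td_sd]
  ring

lemma el_normal_zero (h0 : smoothFun I) : el (jf (sd 0 h0)) = jf (sd 1 h0) := by
  rw [el_eq_of_order_two fun k => by simp]
  simp [pd_zero_sd]

lemma el_normal_two (h1 : smoothFun I) :
    el (jf (sd 0 h1) * ju 1 ^ 2) =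
    -2 * jf (sd 0 h1) * ju 2 - jf (sd 1 h1) * ju 1 ^ 2 := by
  rw [el_eq_of_order_two fun k => by simp [Derivation.leibniz, Derivation.leibniz_pow]]
  simp [Derivation.leibniz, Derivation.leibniz_pow, derivation_ofNat, pd_zero_sd, td_sd]
  ring

lemma el_normal_four (h2 h3 : smoothFun I) :
    el (jf (sd 0 h2) * ju 1 ^ 4 + jf (sd 0 h3) * ju 2 ^ 2) =
    -12 * jf (sd 0 h2) * ju 1 ^ 2 * ju 2 - 3 * jf (sd 1 h2) * ju 1 ^ 4 + 2 * jf (sd 0 h3) * ju 4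
      + 4 * jf (sd 1 h3) * ju 1 * ju 3 + 3 * jf (sd 1 h3) * ju 2 ^ 2 + 2 * jf (sd 2 h3) *
      ju 1 ^ 2 * ju 2 := by
  rw [el_eq_of_order_two fun k => by simp [Derivation.leibniz, Derivation.leibniz_pow]]
  simp [Derivation.leibniz, Derivation.leibniz_pow, derivation_ofNat, pd_zero_sd, td_sd]
  ring

lemma el_reduced_two (z a b : smoothFun I) :
    el (jf (sd 0 z) * ju 1 ^ 2 + jx * (jf (sd 0 a) * ju 1 ^ 3) + jt * (jf (sd 0 b) * ju 1 ^ 3)) =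
    -6 * jf (sd 0 a) * ju 1 * ju 2 * jx - 3 * jf (sd 0 a) * ju 1 ^ 2 - 2 * jf (sd 1 a) *
      ju 1 ^ 3 * jx - 6 * jf (sd 0 b) * ju 1 * ju 2 * jt - 2 * jf (sd 1 b) * ju 1 ^ 3 * jt
      - ju 1 ^ 2 * jf (sd 1 z) - 2 * ju 2 * jf (sd 0 z) := by
  rw [el_eq_of_order_two fun k => by simp [Derivation.leibniz, Derivation.leibniz_pow]]
  simp [Derivation.leibniz, Derivation.leibniz_pow, derivation_ofNat, pd_zero_sd, td_sd]
  ring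

lemma el_reduced_four (z w a b f g : smoothFun I) :
    el (jf (sd 0 z) * ju 2 ^ 2 + jf (sd 0 w) * ju 1 ^ 4
      + jx * (jf (sd 0 a) * (ju 1 * ju 2 ^ 2) + jf (sd 0 b) * ju 1 ^ 5)
      + jt * (jf (sd 0 f) * (ju 1 * ju 2 ^ 2) + jf (sd 0 g) * ju 1 ^ 5)) =
    4 * jf (sd 0 a) * ju 1 * ju 3 + 2 * jf (sd 0 a) * ju 1 * ju 4 * jx + 4 * jf (sd 0 a) * ju 2
      * ju 3 * jx + 3 * jf (sd 0 a) * ju 2 ^ 2 + 6 * jf (sd 1 a) * ju 1 * ju 2 ^ 2 * jx + 4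
      * jf (sd 1 a) * ju 1 ^ 2 * ju 2 + 4 * jf (sd 1 a) * ju 1 ^ 2 * ju 3 * jx + 2 *
      jf (sd 2 a) * ju 1 ^ 3 * ju 2 * jx - 20 * jf (sd 0 b) * ju 1 ^ 3 * ju 2 * jx - 5 *
      jf (sd 0 b) * ju 1 ^ 4 - 4 * jf (sd 1 b) * ju 1 ^ 5 * jx + 2 * jf (sd 0 f) * ju 1 *
      ju 4 * jt + 4 * jf (sd 0 f) * ju 2 * ju 3 * jt + 6 * jf (sd 1 f) * ju 1 * ju 2 ^ 2 *
      jt + 4 * jf (sd 1 f) * ju 1 ^ 2 * ju 3 * jt + 2 * jf (sd 2 f) * ju 1 ^ 3 * ju 2 * jt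
      - 20 * jf (sd 0 g) * ju 1 ^ 3 * ju 2 * jt - 4 * jf (sd 1 g) * ju 1 ^ 5 * jt + 4 * ju 1
      * ju 3 * jf (sd 1 z) - 12 * ju 1 ^ 2 * ju 2 * jf (sd 0 w) + 2 * ju 1 ^ 2 * ju 2 *
      jf (sd 2 z) - 3 * ju 1 ^ 4 * jf (sd 1 w) + 3 * ju 2 ^ 2 * jf (sd 1 z) + 2 * ju 4 *
      jf (sd 0 z) := by
  rw [el_eq_of_order_two fun k => by simp [Derivation.leibniz, Derivation.leibniz_pow]]
  simp [Derivation.leibniz, Derivation.leibniz_pow, derivation_ofNat, pd_zero_sd, td_sd]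
  ring

end JetSpace

/-! ### Obstructions, and injectivity of the Euler–Lagrange operator on reduced densities. -/

namespace JetSpace

variable {I : Opens ℝ}

/-- The coefficient of `u_x²` in the reduced density of the bracket. -/
def squareObs {A : Type*} [CommRing A] (a b h : Fin 4 → ℕ → A) : A :=
  -a 0 1 * h 1 1 - 3 * a 0 2 * h 1 0 - a 1 0 * h 0 2 + b 1 0

/-- The coefficient of `u_x³` in the reduced density of the bracket. -/
def cubicObs {A : Type*} [CommRing A] (a h : Fin 4 → ℕ → A) : A :=
  -a 0 3 * h 1 0 + a 1 0 * h 0 3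

/-- The coefficient of `u_xx²` in the reduced density of the bracket. -/
def bendObs {A : Type*} [CommRing A] (a b h : Fin 4 → ℕ → A) : A :=
  -6 * a 0 1 * h 3 1 - 30 * a 0 2 * h 3 0 - 36 * a 1 0 * h 1 0 - 6 * a 3 0 * h 0 2 + 6 * b 3 0

/-- The coefficient of `u_x⁴` in the reduced density of the bracket. -/
def quarticObs {A : Type*} [CommRing A] (a b h : Fin 4 → ℕ → A) (e : ℕ → A) : A :=
  -6 * a 0 1 * h 2 1 - 42 * a 0 2 * h 2 0 + 12 * a 0 3 * h 3 1 + 15 * a 0 4 * h 3 0 + a 1 0 *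
    h 1 2 + a 1 1 * h 1 1 + 15 * a 1 2 * h 1 0 - 6 * a 2 0 * h 0 2 - 3 * a 3 0 * h 0 4 + 6 *
    b 2 0 + 12 * e 0 * h 0 3

/-- The coefficient of `u_x u_xx²` in the reduced density of the bracket. -/
def mixedObs {A : Type*} [CommRing A] (a h : Fin 4 → ℕ → A) : A :=
  -30 * a 0 3 * h 3 0 + 36 * a 1 0 * h 1 1 - 36 * a 1 1 * h 1 0 + 30 * a 3 0 * h 0 3

/-- The coefficient of `u_x⁵` in the reduced density of the bracket. -/
def quinticObs {A : Type*} [CommRing A] (a h : Fin 4 → ℕ → A) : A :=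
  -18 * a 0 3 * h 2 0 + 3 * a 0 4 * h 3 1 + 3 * a 0 5 * h 3 0 - 3 * a 1 0 * h 1 3 + 3 * a 1 3
    * h 1 0 + 18 * a 2 0 * h 0 3 - 3 * a 3 0 * h 0 5 - 3 * a 3 1 * h 0 4

/-- The derivatives of the coefficients, as differential polynomials. -/
def cj (f : Fin 4 → smoothFun I) (i : Fin 4) (n : ℕ) : jetAlgebra I := jf (sd n (f i))

lemma jf_eq_zero {f : smoothFun I} (hf : ∀ v ∈ I, f.1 v = 0) : jf f = 0 :=
  eq_zero_of_ev fun q => hf _ q.2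

/-- Elements of `smoothFun I` are functions on all of `ℝ`, while `jf` retains only their values on
`I`. This is why later equations are stated for `jf f` and not for `f`. -/
lemma jf_eq_zero_iff {f : smoothFun I} : jf f = 0 ↔ ∀ v ∈ I, f.1 v = 0 := by
  refine ⟨fun h v hv => ?_, jf_eq_zero⟩
  simpa using congrArg (ev ⟨(0, 0, fun _ => v), hv⟩) h

/-- The jet `(u, u_x, u_xx, …) = (v, y₁, y₂, y₃, y₄, 0, …)` at `(x, t)`. -/
def jetPoint (v : ℝ) (hv : v ∈ I) (x t y₁ y₂ y₃ y₄ : ℝ) : JetSpace I :=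
  ⟨(x, t, fun n => match n with
    | 0 => v | 1 => y₁ | 2 => y₂ | 3 => y₃ | 4 => y₄ | _ => 0), hv⟩

/-- In the variational derivative `u_xx` has coefficient `-2z - 6 x u_x a - 6 t u_x b`. Its
vanishing at suitable jets isolates `z`, `a` and `b`. -/
lemma el_reduced_two_eq_zero_iff (z a b : smoothFun I) :
    el (jf z * ju 1 ^ 2 + jx * (jf a * ju 1 ^ 3) + jt * (jf b * ju 1 ^ 3)) = 0 ↔
      jf z = 0 ∧ jf a = 0 ∧ jf b = 0 := by
  refine ⟨fun h => ?_, fun ⟨hz, ha, hb⟩ => by simp [hz, ha, hb]⟩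
  have h' := el_reduced_two z a b
  simp only [sd_zero] at h'
  rw [h] at h'
  have key := fun v hv x t y₁ y₂ =>
    congrArg (ev (jetPoint v hv x t y₁ y₂ 0 0)) h'
  simp [jetPoint] at key
  have hz : ∀ v ∈ I, z.1 v = 0 := fun v hv => by
    have := key v hv 0 0 0 1
    linarith
  have ha : ∀ v ∈ I, a.1 v = 0 := fun v hv => by
    have h1 := key v hv 1 0 1 1
    have h2 := key v hv 1 0 1 0
    linarith [hz v hv]
  have hb : ∀ v ∈ I, b.1 v = 0 := fun v hv => by
    have h1 := key v hv 0 1 1 1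
    have h2 := key v hv 0 1 1 0
    linarith [hz v hv]
  exact ⟨jf_eq_zero hz, jf_eq_zero ha, jf_eq_zero hb⟩

/-- The coefficient `2z + 2 x u_x a + 2 t u_x f` of the fourth derivative of `u` eliminates `z`,
`a`, `f`. Then the coefficient `-12 u_x² w - 20 x u_x³ b - 20 t u_x³ g` of `u_xx` eliminates the
rest. -/
lemma el_reduced_four_eq_zero_iff (z w a b f g : smoothFun I) :
    el (jf z * ju 2 ^ 2 + jf w * ju 1 ^ 4
      + jx * (jf a * (ju 1 * ju 2 ^ 2) + jf b * ju 1 ^ 5)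
      + jt * (jf f * (ju 1 * ju 2 ^ 2) + jf g * ju 1 ^ 5)) = 0 ↔
      jf z = 0 ∧ jf w = 0 ∧ (jf a = 0 ∧ jf b = 0) ∧ jf f = 0 ∧ jf g = 0 := by
  refine ⟨fun h => ?_, fun ⟨hz, hw, ⟨ha, hb⟩, hf, hg⟩ => by simp [hz, hw, ha, hb, hf, hg]⟩
  have h' := el_reduced_four z w a b f g
  simp only [sd_zero] at h'
  rw [h] at h'
  have key := fun v hv x t y₁ y₂ y₃ y₄ =>
    congrArg (ev (jetPoint v hv x t y₁ y₂ y₃ y₄)) h'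
  simp [jetPoint] at key
  have hz : ∀ v ∈ I, z.1 v = 0 := fun v hv => by
    have := key v hv 0 0 0 0 0 1
    linarith
  have ha : ∀ v ∈ I, a.1 v = 0 := fun v hv => by
    have h1 := key v hv 1 0 1 0 0 1
    have h2 := key v hv 1 0 1 0 0 0
    linarith [hz v hv]
  have hf : ∀ v ∈ I, f.1 v = 0 := fun v hv => by
    have h1 := key v hv 0 1 1 0 0 1
    have h2 := key v hv 0 1 1 0 0 0
    linarith [hz v hv]
  have hz' : jf z = 0 := jf_eq_zero hz
  have ha' : jf a = 0 := jf_eq_zero ha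
  have hf' : jf f = 0 := jf_eq_zero hf
  -- Restarting with zero in place of `z`, `a`, `f` also removes all terms with their derivatives.
  have h'' := el_reduced_four 0 w 0 b 0 g
  simp only [sd_zero, map_zero] at h''
  rw [hz', ha', hf'] at h
  rw [h] at h''
  have hsd : ∀ n, jf (sd n (0 : smoothFun I)) = 0 := fun n => jf_eq_zero fun v _ => by
    simp
  simp only [hsd] at h''
  have key := fun v hv x t y₁ y₂ =>
    congrArg (ev (jetPoint v hv x t y₁ y₂ 0 0)) h''
  simp [jetPoint] at key
  have hw : ∀ v ∈ I, w.1 v = 0 := fun v hv => by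
    have h1 := key v hv 0 0 1 1
    have h2 := key v hv 0 0 1 0
    linarith
  have hb : ∀ v ∈ I, b.1 v = 0 := fun v hv => by
    have h1 := key v hv 1 0 1 1
    have h2 := key v hv 1 0 1 0
    linarith [hw v hv]
  have hg : ∀ v ∈ I, g.1 v = 0 := fun v hv => by
    have h1 := key v hv 0 1 1 1
    have h2 := key v hv 0 1 1 0
    linarith [hw v hv]
  exact ⟨hz', jf_eq_zero hw, ⟨ha', jf_eq_zero hb⟩, hf', jf_eq_zero hg⟩

end JetSpace

/-! ### Expansion of the conservation condition in powers of `ε`. -/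

namespace JetSpace

variable {I : Opens ℝ}

/-- The density `f₀ + ε² f₁ u_x² + ε⁴ (f₂ u_x⁴ + f₃ u_xx²)`. -/
def normalJet (f : Fin 4 → smoothFun I) (ε : ℝ) : jetAlgebra I :=
  jf (sd 0 (f 0)) + ε ^ 2 • (jf (sd 0 (f 1)) * ju 1 ^ 2)
    + ε ^ 4 • (jf (sd 0 (f 2)) * ju 1 ^ 4 + jf (sd 0 (f 3)) * ju 2 ^ 2)

/-- The density `x α + ε⁴ e u_x³ + t β`. -/
def stringJet (a b : Fin 4 → smoothFun I) (e : smoothFun I) (ε : ℝ) : jetAlgebra I :=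
  jx * normalJet a ε + ε ^ 4 • (jf (sd 0 e) * ju 1 ^ 3) + jt * normalJet b ε

/-- The coefficient of `ε²` in the variational derivative of `stringJet`. -/
def stringTwo (a b : Fin 4 → smoothFun I) : jetAlgebra I :=
  -2 * cj a 1 0 * ju 1 - 2 * cj a 1 0 * ju 2 * jx - cj a 1 1 * ju 1 ^ 2 * jx - 2 * cj b 1 0 *
    ju 2 * jt - cj b 1 1 * ju 1 ^ 2 * jt

/-- The coefficient of `ε⁴` in the variational derivative of `stringJet`. -/
def stringFour (a b : Fin 4 → smoothFun I) (e : smoothFun I) : jetAlgebra I :=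
  -12 * cj a 2 0 * ju 1 ^ 2 * ju 2 * jx - 4 * cj a 2 0 * ju 1 ^ 3 - 3 * cj a 2 1 * ju 1 ^ 4 * jx
    + 4 * cj a 3 0 * ju 3 + 2 * cj a 3 0 * ju 4 * jx + 4 * cj a 3 1 * ju 1 * ju 2 + 4 * cj a 3 1
    * ju 1 * ju 3 * jx + 3 * cj a 3 1 * ju 2 ^ 2 * jx + 2 * cj a 3 2 * ju 1 ^ 2 * ju 2 * jx - 12
    * cj b 2 0 * ju 1 ^ 2 * ju 2 * jt - 3 * cj b 2 1 * ju 1 ^ 4 * jt + 2 * cj b 3 0 * ju 4 * jt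
    + 4 * cj b 3 1 * ju 1 * ju 3 * jt + 3 * cj b 3 1 * ju 2 ^ 2 * jt + 2 * cj b 3 2 * ju 1 ^ 2 *
    ju 2 * jt - 6 * jf (sd 0 e) * ju 1 * ju 2 - 2 * jf (sd 1 e) * ju 1 ^ 3

/-- The coefficient of `ε²` in the variational derivative of `normalJet`. -/
def normalTwo (h : Fin 4 → smoothFun I) : jetAlgebra I :=
  -2 * cj h 1 0 * ju 2 - cj h 1 1 * ju 1 ^ 2

/-- The coefficient of `ε⁴` in the variational derivative of `normalJet`. -/
def normalFour (h : Fin 4 → smoothFun I) : jetAlgebra I :=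
  -12 * cj h 2 0 * ju 1 ^ 2 * ju 2 - 3 * cj h 2 1 * ju 1 ^ 4 + 2 * cj h 3 0 * ju 4 + 4 *
    cj h 3 1 * ju 1 * ju 3 + 3 * cj h 3 1 * ju 2 ^ 2 + 2 * cj h 3 2 * ju 1 ^ 2 * ju 2

lemma el_normalJet (h : Fin 4 → smoothFun I) (ε : ℝ) :
    el (normalJet h ε) = cj h 0 1 + ε ^ 2 • normalTwo h + ε ^ 4 • normalFour h := by
  rw [normalJet, map_add, map_add, map_smul, map_smul, el_normal_zero, el_normal_two,
    el_normal_four]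
  rfl

lemma el_stringJet (a b : Fin 4 → smoothFun I) (e : smoothFun I) (ε : ℝ) :
    el (stringJet a b e ε) =
      cj a 0 1 * jx + cj b 0 1 * jt + ε ^ 2 • stringTwo a b + ε ^ 4 • stringFour a b e := by
  have : stringJet a b e ε = jx * jf (sd 0 (a 0)) + jt * jf (sd 0 (b 0))
      + ε ^ 2 • (jx * (jf (sd 0 (a 1)) * ju 1 ^ 2) + jt * (jf (sd 0 (b 1)) * ju 1 ^ 2))
      + ε ^ 4 • (jx * (jf (sd 0 (a 2)) * ju 1 ^ 4 + jf (sd 0 (a 3)) * ju 2 ^ 2)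
        + jf (sd 0 e) * ju 1 ^ 3
        + jt * (jf (sd 0 (b 2)) * ju 1 ^ 4 + jf (sd 0 (b 3)) * ju 2 ^ 2)) := by
    simp only [stringJet, normalJet, mul_add, mul_smul_comm, smul_add]
    abel
  rw [this, map_add, map_add, map_smul, map_smul, el_string_zero, el_string_two, el_string_four]
  rfl

lemma td_cj (f : Fin 4 → smoothFun I) (i : Fin 4) (n : ℕ) :
    td (cj f i n) = cj f i (n + 1) * ju 1 := td_sd n (f i)

/-- The part of order zero of the density of the bracket. -/
def bracketZero (a b h : Fin 4 → smoothFun I) : jetAlgebra I :=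
  jf (sd 0 (b 0)) + (cj a 0 1 * jx + cj b 0 1 * jt) * td (cj h 0 1)

/-- The part of order two of the density of the bracket. -/
def bracketTwo (a b h : Fin 4 → smoothFun I) : jetAlgebra I :=
  cj b 1 0 * ju 1 ^ 2 + (cj a 0 1 * jx + cj b 0 1 * jt) * td (normalTwo h)
    + stringTwo a b * td (cj h 0 1)

/-- The part of order four of the density of the bracket. -/
def bracketFour (a b h : Fin 4 → smoothFun I) (e : smoothFun I) : jetAlgebra I :=
  cj b 2 0 * ju 1 ^ 4 + cj b 3 0 * ju 2 ^ 2 + (cj a 0 1 * jx + cj b 0 1 * jt) * td (normalFour h)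
    + stringTwo a b * td (normalTwo h) + stringFour a b e * td (cj h 0 1)

/-- The summand `normalJet b ε` accounts for the explicit time dependence: its variational
derivative is `∂_t δS/δu`. With it, `el` of the left side is the whole conservation defect. -/
lemma bracket_expansion (a b h : Fin 4 → smoothFun I) (e : smoothFun I) (ε : ℝ) :
    normalJet b ε + el (stringJet a b e ε) * td (el (normalJet h ε)) =
      bracketZero a b h + ε ^ 2 • bracketTwo a b h + ε ^ 4 • bracketFour a b h e
      + ε ^ 6 • (stringTwo a b * td (normalFour h) + stringFour a b e * td (normalTwo h))
      + ε ^ 8 • (stringFour a b e * td (normalFour h)) := by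
  rw [el_stringJet, el_normalJet, normalJet, bracketZero, bracketTwo, bracketFour]
  simp only [map_add, Derivation.map_smul]
  simp only [Algebra.smul_def, map_pow, cj]
  ring

lemma el_bracketZero (a b h : Fin 4 → smoothFun I) :
    el (bracketZero a b h) = cj b 0 1 - cj a 0 1 * cj h 0 2 := by
  rw [bracketZero, td_cj]
  simp only [cj]
  rw [el_eq_of_order_two fun k => by simp [Derivation.leibniz]]
  simp [Derivation.leibniz, pd_zero_sd, td_sd]
  ring

lemma jf_ofNat (n : ℕ) [n.AtLeastTwo] :
    jf (no_index (OfNat.ofNat n : smoothFun I)) = OfNat.ofNat n := map_ofNat _ n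

lemma el_bracketTwo_eq_zero_iff (a b h : Fin 4 → smoothFun I) :
    el (bracketTwo a b h) = 0 ↔
      squareObs (cj a) (cj b) (cj h) = 0 ∧ cubicObs (cj a) (cj h) = 0 ∧
        cubicObs (cj b) (cj h) = 0 := by
  have key := bracket_order_two (A := jetAlgebra I) td (a0 := cj a 0) (a1 := cj a 1)
    (b0 := cj b 0) (b1 := cj b 1) (h0 := cj h 0) (h1 := cj h 1) td_jx td_jt td_ju (td_cj a 0)
    (td_cj a 1) (td_cj b 0) (td_cj b 1) (td_cj h 0) (td_cj h 1)
  -- The injectivity lemma needs coefficients that come from functions of `u`. The obstructions make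
  -- sense in any commutative ring, so they are formed in `smoothFun I` and carried over by `jf`.
  let s (f : Fin 4 → smoothFun I) (i : Fin 4) (n : ℕ) : smoothFun I := sd n (f i)
  have hz : jf (squareObs (s a) (s b) (s h)) = squareObs (cj a) (cj b) (cj h) := by
    simp only [squareObs, map_add, map_sub, map_neg, map_mul, jf_ofNat, s, cj]
  have ha : ∀ f, jf (cubicObs (s f) (s h)) = cubicObs (cj f) (cj h) := fun f => by
    simp only [cubicObs, map_add, map_neg, map_mul, s, cj]
  rw [← hz, ← ha a, ← ha b, ← el_reduced_two_eq_zero_iff, hz, ha a, ha b]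
  have h' := congrArg el key
  rw [map_add _ _ (td _), el_td, add_zero] at h'
  exact Eq.congr_left h'

lemma el_bracketFour_eq_zero_iff (a b h : Fin 4 → smoothFun I) (e : smoothFun I) :
    el (bracketFour a b h e) = 0 ↔
      bendObs (cj a) (cj b) (cj h) = 0 ∧
      quarticObs (cj a) (cj b) (cj h) (fun n => jf (sd n e)) = 0 ∧
      (mixedObs (cj a) (cj h) = 0 ∧ quinticObs (cj a) (cj h) = 0) ∧
      mixedObs (cj b) (cj h) = 0 ∧ quinticObs (cj b) (cj h) = 0 := by
  have key := bracket_order_four (A := jetAlgebra I) td (a0 := cj a 0) (a1 := cj a 1)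
    (a2 := cj a 2) (a3 := cj a 3) (b0 := cj b 0) (b1 := cj b 1) (b2 := cj b 2) (b3 := cj b 3)
    (h0 := cj h 0) (h1 := cj h 1) (h2 := cj h 2) (h3 := cj h 3) (e := fun n => jf (sd n e))
    td_jx td_jt td_ju (td_cj a 0) (td_cj a 1) (td_cj a 2) (td_cj a 3) (td_cj b 0) (td_cj b 1)
    (td_cj b 2) (td_cj b 3) (td_cj h 0) (td_cj h 1) (td_cj h 2) (td_cj h 3) fun n => td_sd n e
  let s (f : Fin 4 → smoothFun I) (i : Fin 4) (n : ℕ) : smoothFun I := sd n (f i)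
  have hz : jf (bendObs (s a) (s b) (s h)) = bendObs (cj a) (cj b) (cj h) := by
    simp only [bendObs, map_add, map_sub, map_neg, map_mul, jf_ofNat, s, cj]
  have hw : jf (quarticObs (s a) (s b) (s h) fun n => sd n e) =
      quarticObs (cj a) (cj b) (cj h) fun n => jf (sd n e) := by
    simp only [quarticObs, map_add, map_sub, map_neg, map_mul, jf_ofNat, s, cj]
  have hm : ∀ f, jf (mixedObs (s f) (s h)) = mixedObs (cj f) (cj h) := fun f => by
    simp only [mixedObs, map_add, map_sub, map_neg, map_mul, jf_ofNat, s, cj]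
  have hq : ∀ f, jf (quinticObs (s f) (s h)) = quinticObs (cj f) (cj h) := fun f => by
    simp only [quinticObs, map_add, map_sub, map_neg, map_mul, jf_ofNat, s, cj]
  rw [← hz, ← hw, ← hm a, ← hm b, ← hq a, ← hq b, ← el_reduced_four_eq_zero_iff, hz, hw, hm a, hm b,
    hq a, hq b]
  have h' := congrArg el key
  rw [map_add _ _ (td _), el_td, add_zero] at h'
  have h6 : el (6 * bracketFour a b h e) = 0 ↔ el (bracketFour a b h e) = 0 := by
    have : ∀ m : jetAlgebra I, 6 * m = (6 : ℝ) • m := fun m => by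
      rw [Algebra.smul_def, map_ofNat]
    rw [this, map_smul, smul_eq_zero_iff_right (by norm_num)]
  rw [← h6]
  exact Eq.congr_left h'

end JetSpace

/-! ### Conservation as a system of differential equations. -/

namespace JetSpace

variable {I : Opens ℝ}

/-- The coefficients are removed from the lowest order up: after subtracting the higher powers, `ε ^
n * z` is `o(ε ^ n)`, which forces `z = 0`. -/
lemma isBigO_even_polynomial_iff (z₀ z₂ z₄ z₆ z₈ : ℝ) :
    (fun ε : ℝ => z₀ + ε ^ 2 * z₂ + ε ^ 4 * z₄ + ε ^ 6 * z₆ + ε ^ 8 * z₈) =O[𝓝 0]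
      (fun ε : ℝ => ε ^ 6) ↔ z₀ = 0 ∧ z₂ = 0 ∧ z₄ = 0 := by
  have hlt : ∀ m n : ℕ, m < n → ∀ z : ℝ, (fun ε : ℝ => ε ^ n * z) =o[𝓝 0] fun ε : ℝ => ε ^ m := by
    intro m n hmn z
    simpa only [mul_comm] using (isLittleO_pow_pow hmn).const_mul_left z
  have hzero : ∀ (n : ℕ) (z : ℝ), (fun ε : ℝ => ε ^ n * z) =o[𝓝 0] (fun ε : ℝ => ε ^ n) →
      z = 0 := by
    intro n z h
    by_contra hne
    have h1 : (fun ε : ℝ => ε ^ n) =o[𝓝 0] fun ε : ℝ => ε ^ n := by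
      simpa [mul_comm, hne] using h.const_mul_left z⁻¹
    -- Passing to the punctured neighbourhood supplies the points with `ε ^ n ≠ 0` needed for the
    -- contradiction.
    refine isLittleO_irrefl ?_ (h1.mono (nhdsWithin_le_nhds (s := {0}ᶜ)))
    refine Eventually.frequently ?_
    filter_upwards [self_mem_nhdsWithin] with ε hε
    exact pow_ne_zero n hε
  have h6 : ∀ z : ℝ, (fun ε : ℝ => ε ^ 6 * z) =O[𝓝 0] fun ε : ℝ => ε ^ 6 := fun z => by
    simpa only [mul_comm] using (isBigO_refl (fun ε : ℝ => ε ^ 6) (𝓝 0)).const_mul_left z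
  constructor
  · intro h
    have h0 : z₀ = 0 := by
      refine hzero 0 _ ?_
      refine (((((h.trans_isLittleO (isLittleO_pow_pow (by norm_num : 0 < 6))).sub
        (hlt 0 2 (by norm_num) z₂)).sub (hlt 0 4 (by norm_num) z₄)).sub
        (hlt 0 6 (by norm_num) z₆)).sub (hlt 0 8 (by norm_num) z₈)).congr_left fun ε => ?_
      ring
    subst h0
    have h2 : z₂ = 0 := by
      refine hzero 2 _ ?_
      refine ((((h.trans_isLittleO (isLittleO_pow_pow (by norm_num : 2 < 6))).sub
        (hlt 2 4 (by norm_num) z₄)).sub (hlt 2 6 (by norm_num) z₆)).sub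
        (hlt 2 8 (by norm_num) z₈)).congr_left fun ε => ?_
      ring
    subst h2
    refine ⟨rfl, rfl, hzero 4 _ ?_⟩
    refine (((h.trans_isLittleO (isLittleO_pow_pow (by norm_num : 4 < 6))).sub
      (hlt 4 6 (by norm_num) z₆)).sub (hlt 4 8 (by norm_num) z₈)).congr_left fun ε => ?_
    ring
  · rintro ⟨rfl, rfl, rfl⟩
    refine ((h6 z₆).add (hlt 6 8 (by norm_num) z₈).isBigO).congr_left fun ε => ?_
    ring

/-- The equations on the coefficients that express conservation up to `O(ε⁶)`. -/
structure StringEquations {A : Type*} [CommRing A] (a b h : Fin 4 → ℕ → A) (e : ℕ → A) : Prop where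
  flux : b 0 1 - a 0 1 * h 0 2 = 0
  square : squareObs a b h = 0
  cubic_left : cubicObs a h = 0
  cubic_right : cubicObs b h = 0
  bend : bendObs a b h = 0
  quartic : quarticObs a b h e = 0
  mixed_left : mixedObs a h = 0
  quintic_left : quinticObs a h = 0
  mixed_right : mixedObs b h = 0
  quintic_right : quinticObs b h = 0

lemma stringEquations_iff (a b h : Fin 4 → smoothFun I) (e : smoothFun I) :
    StringEquations (cj a) (cj b) (cj h) (fun n => jf (sd n e)) ↔
      el (bracketZero a b h) = 0 ∧ el (bracketTwo a b h) = 0 ∧ el (bracketFour a b h e) = 0 := by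
  rw [el_bracketZero, el_bracketTwo_eq_zero_iff, el_bracketFour_eq_zero_iff]
  exact ⟨fun ⟨h1, h2, h3, h4, h5, h6, h7, h8, h9, h10⟩ =>
      ⟨h1, ⟨h2, h3, h4⟩, h5, h6, ⟨h7, h8⟩, h9, h10⟩,
    fun ⟨h1, ⟨h2, h3, h4⟩, h5, h6, ⟨h7, h8⟩, h9, h10⟩ => ⟨h1, h2, h3, h4, h5, h6, h7, h8, h9, h10⟩⟩

/-- The variational derivative of `stringJet` is affine in `t`. -/
lemma deriv_el_stringJet (a b : Fin 4 → smoothFun I) (e : smoothFun I) (ε x t : ℝ) (j : ℕ → ℝ)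
    (hj : j 0 ∈ I) :
    deriv (fun τ => ev ⟨(x, τ, j), hj⟩ (el (stringJet a b e ε))) t =
      ev ⟨(x, t, j), hj⟩ (el (normalJet b ε)) := by
  have key : ∀ τ, ev ⟨(x, τ, j), hj⟩ (el (stringJet a b e ε)) =
      ev ⟨(x, 0, j), hj⟩ (el (stringJet a b e ε)) +
        τ * ev ⟨(x, t, j), hj⟩ (el (normalJet b ε)) := fun τ => by
    simp only [el_stringJet, el_normalJet, stringTwo, stringFour, normalTwo, normalFour, cj, map_add,
      map_sub, map_neg, map_mul, map_pow, map_smul, ev_jx, ev_jt, ev_ju, ev_jf, ev_ofNat,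
      smul_eq_mul]
    ring
  rw [funext key]
  simp

lemma euler_eq_ev {F : Density} {m : jetAlgebra I} (hF : restrict I F = m) (x t : ℝ) (j : ℕ → ℝ)
    (hj : j 0 ∈ I) : euler F x t j = ev ⟨(x, t, j), hj⟩ (el m) :=
  congrFun (restrict_euler hF) ⟨(x, t, j), hj⟩

/-- By `deriv_el_stringJet` the defect is `el` of the density in `bracket_expansion`. At each fixed
jet it is an even polynomial in `ε`, and only its three lowest coefficients matter. -/
theorem isConservedUpTo_iff {a b h : Fin 4 → smoothFun I} {e : smoothFun I} {S H : ℝ → Density}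
    (hS : ∀ ε, restrict I (S ε) = stringJet a b e ε) (hH : ∀ ε, restrict I (H ε) = normalJet h ε) :
    IsConservedUpTo I 6 (fun ε => totalDeriv (euler (H ε))) S ↔
      StringEquations (cj a) (cj b) (cj h) (fun n => jf (sd n e)) := by
  have hprod : ∀ ε, restrict I (fun x t j => euler (S ε) x t j * totalDeriv (euler (H ε)) x t j) =
      (el (stringJet a b e ε) * td (el (normalJet h ε)) : jetAlgebra I) := fun ε => by
    have h1 := restrict_euler (hS ε)
    have h2 : restrict I (totalDeriv (euler (H ε))) = (td (el (normalJet h ε)) : jetAlgebra I) := by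
      rw [restrict_totalDeriv, restrict_euler (hH ε)]; rfl
    funext q
    exact congrArg₂ (· * ·) (congrFun h1 q) (congrFun h2 q)
  have hval : ∀ (x t : ℝ) (j : ℕ → ℝ) (hj : j 0 ∈ I) (ε : ℝ),
      deriv (fun τ => euler (S ε) x τ j) t
        + euler (fun x' t' j' => euler (S ε) x' t' j' * totalDeriv (euler (H ε)) x' t' j') x t j =
      ev ⟨(x, t, j), hj⟩ (el (bracketZero a b h))
        + ε ^ 2 * ev ⟨(x, t, j), hj⟩ (el (bracketTwo a b h))
        + ε ^ 4 * ev ⟨(x, t, j), hj⟩ (el (bracketFour a b h e))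
        + ε ^ 6 * ev ⟨(x, t, j), hj⟩
          (el (stringTwo a b * td (normalFour h) + stringFour a b e * td (normalTwo h)))
        + ε ^ 8 * ev ⟨(x, t, j), hj⟩ (el (stringFour a b e * td (normalFour h))) := by
    intro x t j hj ε
    simp only [euler_eq_ev (hS ε) x _ j hj, deriv_el_stringJet, euler_eq_ev (hprod ε) x t j hj]
    rw [← map_add, ← map_add, bracket_expansion]
    simp only [map_add, map_smul, smul_eq_mul]
  rw [stringEquations_iff]
  constructor
  · intro hc
    have hq := fun q : JetSpace I => by
      have := hc q.1.1 q.1.2.1 q.1.2.2 q.2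
      simp only [hval q.1.1 q.1.2.1 q.1.2.2 q.2] at this
      exact (isBigO_even_polynomial_iff _ _ _ _ _).1 this
    exact ⟨eq_zero_of_ev fun q => (hq q).1, eq_zero_of_ev fun q => (hq q).2.1,
      eq_zero_of_ev fun q => (hq q).2.2⟩
  · rintro ⟨h0, h2, h4⟩ x t j hj
    simp only [hval x t j hj]
    refine (isBigO_even_polynomial_iff _ _ _ _ _).2 ?_
    simp [h0, h2, h4]

end JetSpace

/-! ### Coefficients of the `D`-operator and their derivatives. -/

namespace JetSpace

variable {I : Opens ℝ}

/-- The coefficients of `D_{(c,p,s)}(f)`. -/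
def dForm (c p s f : smoothFun I) : Fin 4 → smoothFun I :=
  ![f, (-1 / 2 : ℝ) • (sd 0 c * sd 3 f),
    sd 0 s * sd 3 f - (1 / 8 : ℝ) • (sd 0 c * sd 2 c * sd 4 f)
      - (1 / 8 : ℝ) • (sd 0 c * sd 1 c * sd 5 f) - (1 / 24 : ℝ) • (sd 0 c ^ 2 * sd 6 f)
      - (1 / 6 : ℝ) • (sd 1 p * sd 4 f) - (1 / 6 : ℝ) • (sd 0 p * sd 5 f),
    sd 0 p * sd 3 f + (3 / 10 : ℝ) • (sd 0 c ^ 2 * sd 4 f)]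

lemma jf_sd_succ (n : ℕ) (f : smoothFun I) : jf (sd (n + 1) f) = pd 0 (jf (sd n f)) :=
  (pd_zero_sd n f).symm

/-- Differentiation in `u` acts on the jet algebra as `pd 0`, so functions that agree on `I` have
the same derivatives there. -/
lemma jf_sd_congr {f g : smoothFun I} (h : jf f = jf g) (n : ℕ) : jf (sd n f) = jf (sd n g) := by
  induction n with
  | zero => rwa [sd_zero, sd_zero]
  | succ n ih => rw [jf_sd_succ, jf_sd_succ, ih]

lemma cj_zero (f : Fin 4 → smoothFun I) (i : Fin 4) : cj f i 0 = jf (f i) := by rw [cj, sd_zero]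

lemma cj_one (f : Fin 4 → smoothFun I) (i : Fin 4) : cj f i 1 = pd 0 (jf (f i)) := by
  rw [cj, jf_sd_succ, sd_zero]

lemma cj_two (f : Fin 4 → smoothFun I) (i : Fin 4) : cj f i 2 = pd 0 (pd 0 (jf (f i))) := by
  rw [cj, jf_sd_succ, ← cj, cj_one]

lemma cj_three (f : Fin 4 → smoothFun I) (i : Fin 4) :
    cj f i 3 = pd 0 (pd 0 (pd 0 (jf (f i)))) := by
  rw [cj, jf_sd_succ, ← cj, cj_two]

section values

variable (c p s f : smoothFun I) (q : JetSpace I)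

lemma ev_dForm_one_zero : ev q (cj (dForm c p s f) 1 0) =
    (-ev q (jf (sd 0 c)) * ev q (jf (sd 3 f))) / 2 := by
  rw [cj_zero]
  simp only [dForm, Matrix.cons_val, map_smul, map_mul, smul_eq_mul]
  ring

lemma ev_dForm_one_one : ev q (cj (dForm c p s f) 1 1) =
    (-ev q (jf (sd 0 c)) * ev q (jf (sd 4 f)) - ev q (jf (sd 1 c)) * ev q (jf (sd 3 f))) / 2 := by
  rw [cj_one]
  simp only [dForm, Matrix.cons_val, map_smul, map_mul, map_add, Derivation.map_smul,
    Derivation.leibniz, pd_zero_sd, smul_eq_mul, Nat.reduceAdd]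
  ring

lemma ev_dForm_one_two : ev q (cj (dForm c p s f) 1 2) =
    (-ev q (jf (sd 0 c)) * ev q (jf (sd 5 f)) - 2 * ev q (jf (sd 1 c)) * ev q (jf (sd 4 f))
      - ev q (jf (sd 2 c)) * ev q (jf (sd 3 f))) / 2 := by
  rw [cj_two]
  simp only [dForm, Matrix.cons_val, map_smul, map_mul, map_add, Derivation.map_smul,
    Derivation.leibniz, pd_zero_sd, smul_eq_mul, Nat.reduceAdd]
  ring

lemma ev_dForm_one_three : ev q (cj (dForm c p s f) 1 3) =
    (-ev q (jf (sd 0 c)) * ev q (jf (sd 6 f)) - 3 * ev q (jf (sd 1 c)) * ev q (jf (sd 5 f)) - 3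
      * ev q (jf (sd 2 c)) * ev q (jf (sd 4 f)) - ev q (jf (sd 3 c)) * ev q (jf (sd 3 f))) / 2 := by
  rw [cj_three]
  simp only [dForm, Matrix.cons_val, map_smul, map_mul, map_add, Derivation.map_smul,
    Derivation.leibniz, pd_zero_sd, smul_eq_mul, Nat.reduceAdd]
  ring

lemma ev_dForm_two_zero : ev q (cj (dForm c p s f) 2 0) =
    (-3 * ev q (jf (sd 0 c)) * ev q (jf (sd 1 c)) * ev q (jf (sd 5 f)) - 3 * ev q (jf (sd 0 c))
      * ev q (jf (sd 2 c)) * ev q (jf (sd 4 f)) - ev q (jf (sd 0 c)) ^ 2 * ev q (jf (sd 6 f))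
      + 24 * ev q (jf (sd 3 f)) * ev q (jf (sd 0 s)) - 4 * ev q (jf (sd 4 f)) *
      ev q (jf (sd 1 p)) - 4 * ev q (jf (sd 5 f)) * ev q (jf (sd 0 p))) / 24 := by
  rw [cj_zero]
  simp only [dForm, Matrix.cons_val, map_smul, map_mul, map_sub, map_pow, smul_eq_mul]
  ring

lemma ev_dForm_two_one : ev q (cj (dForm c p s f) 2 1) =
    (-5 * ev q (jf (sd 0 c)) * ev q (jf (sd 1 c)) * ev q (jf (sd 6 f)) - 6 * ev q (jf (sd 0 c))
      * ev q (jf (sd 2 c)) * ev q (jf (sd 5 f)) - 3 * ev q (jf (sd 0 c)) * ev q (jf (sd 3 c)) *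
      ev q (jf (sd 4 f)) - ev q (jf (sd 0 c)) ^ 2 * ev q (jf (sd 7 f)) - 3 * ev q (jf (sd 1 c))
      * ev q (jf (sd 2 c)) * ev q (jf (sd 4 f)) - 3 * ev q (jf (sd 1 c)) ^ 2 *
      ev q (jf (sd 5 f)) + 24 * ev q (jf (sd 3 f)) * ev q (jf (sd 1 s)) - 4 * ev q (jf (sd 4 f))
      * ev q (jf (sd 2 p)) + 24 * ev q (jf (sd 4 f)) * ev q (jf (sd 0 s)) - 8 *
      ev q (jf (sd 5 f)) * ev q (jf (sd 1 p)) - 4 * ev q (jf (sd 6 f)) * ev q (jf (sd 0 p))) /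
      24 := by
  rw [cj_one]
  simp only [dForm, Matrix.cons_val, map_smul, map_mul, map_pow, map_add, map_sub, Derivation.map_smul,
    Derivation.leibniz, Derivation.leibniz_pow, pd_zero_sd, smul_eq_mul, nsmul_eq_mul,
    Nat.cast_ofNat, ev_ofNat, Nat.reduceAdd, Nat.reduceSub, pow_one]
  ring

lemma ev_dForm_three_zero : ev q (cj (dForm c p s f) 3 0) =
    (3 * ev q (jf (sd 0 c)) ^ 2 * ev q (jf (sd 4 f)) + 10 * ev q (jf (sd 3 f)) *
      ev q (jf (sd 0 p))) / 10 := by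
  rw [cj_zero]
  simp only [dForm, Matrix.cons_val, map_smul, map_mul, map_add, map_pow, smul_eq_mul]
  ring

lemma ev_dForm_three_one : ev q (cj (dForm c p s f) 3 1) =
    (6 * ev q (jf (sd 0 c)) * ev q (jf (sd 1 c)) * ev q (jf (sd 4 f)) + 3 *
      ev q (jf (sd 0 c)) ^ 2 * ev q (jf (sd 5 f)) + 10 * ev q (jf (sd 3 f)) * ev q (jf (sd 1 p))
      + 10 * ev q (jf (sd 4 f)) * ev q (jf (sd 0 p))) / 10 := by
  rw [cj_one]
  simp only [dForm, Matrix.cons_val, map_smul, map_mul, map_pow, map_add, Derivation.map_smul,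
    Derivation.leibniz, Derivation.leibniz_pow, pd_zero_sd, smul_eq_mul, nsmul_eq_mul,
    Nat.cast_ofNat, ev_ofNat, Nat.reduceAdd, Nat.reduceSub, pow_one]
  ring

end values

end JetSpace

/-! ### Factorization of the obstructions for `H_h = ∫ D(h)`. -/

namespace JetSpace

variable {I : Opens ℝ} {c p s h f : smoothFun I} {a b : Fin 4 → smoothFun I}

lemma eq_of_ev {m n : jetAlgebra I} (h : ∀ q, ev q m = ev q n) : m = n :=
  Subtype.ext (funext h)

lemma ev_dForm_apply_zero (n : ℕ) (q : JetSpace I) :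
    ev q (cj (dForm c p s f) 0 n) = ev q (jf (sd n f)) := rfl

lemma cubicObs_dForm :
    cubicObs (cj a) (cj (dForm c p s h)) =
      (jf (a 1) - jf (dForm c p s (a 0) 1)) * jf (sd 3 h) := by
  refine eq_of_ev fun q => ?_
  simp only [cubicObs, ← cj_zero, map_add, map_sub, map_neg, map_mul, ev_dForm_one_zero,
    ev_dForm_apply_zero]
  simp only [cj]
  ring

/-- With `a₁ = -c a₀'''/2` and `h₁ = -c h'''/2`, the terms in `a₁` and `h₁` give `9 c² (a₀''' h⁗ -
a₀⁗ h''')`. The coefficient `3/10` in `p_f` is the one for which `30 · 3/10 = 9` cancels them,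
leaving only the deviation of `a₃` from its value in `D(a₀)`. -/
lemma mixedObs_dForm (h1 : jf (a 1) = jf (dForm c p s (a 0) 1)) :
    mixedObs (cj a) (cj (dForm c p s h)) =
      (30 : ℝ) • ((jf (a 3) - jf (dForm c p s (a 0) 3)) * jf (sd 3 h)) := by
  have h1' : cj a 1 = cj (dForm c p s (a 0)) 1 := funext (jf_sd_congr h1)
  refine eq_of_ev fun q => ?_
  simp only [mixedObs, ← cj_zero, h1', map_add, map_sub, map_neg, map_mul, map_smul, ev_ofNat,
    smul_eq_mul, ev_dForm_one_zero, ev_dForm_one_one, ev_dForm_three_zero, ev_dForm_apply_zero]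
  simp only [cj]
  ring

lemma quinticObs_dForm (h1 : jf (a 1) = jf (dForm c p s (a 0) 1))
    (h3 : jf (a 3) = jf (dForm c p s (a 0) 3)) :
    quinticObs (cj a) (cj (dForm c p s h)) =
      (18 : ℝ) • ((jf (a 2) - jf (dForm c p s (a 0) 2)) * jf (sd 3 h)) := by
  have h1' : cj a 1 = cj (dForm c p s (a 0)) 1 := funext (jf_sd_congr h1)
  have h3' : cj a 3 = cj (dForm c p s (a 0)) 3 := funext (jf_sd_congr h3)
  refine eq_of_ev fun q => ?_
  simp only [quinticObs, ← cj_zero, h1', h3', map_add, map_sub, map_neg, map_mul, map_smul, ev_ofNat,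
    smul_eq_mul, ev_dForm_one_zero, ev_dForm_one_three, ev_dForm_two_zero, ev_dForm_three_zero,
    ev_dForm_three_one, ev_dForm_apply_zero]
  simp only [cj]
  ring

section flux

variable {f g : smoothFun I} (hg : jf (sd 1 g) = jf (sd 1 f) * jf (sd 2 h))
include hg

/-- Leibniz's rule for `g' = f' h''`. These relations, up to sixth order, eliminate `β₀` from the
`u_x²`, `u_xx²` and `u_x⁴` equations. -/
lemma jf_sd_two_of_flux :
    jf (sd 2 g) = jf (sd 2 f) * jf (sd 2 h) + jf (sd 1 f) * jf (sd 3 h) := by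
  rw [jf_sd_succ, hg, Derivation.leibniz, pd_zero_sd, pd_zero_sd, smul_eq_mul, smul_eq_mul]
  ring

lemma jf_sd_three_of_flux :
    jf (sd 3 g) = jf (sd 3 f) * jf (sd 2 h) + 2 * jf (sd 2 f) * jf (sd 3 h)
      + jf (sd 1 f) * jf (sd 4 h) := by
  rw [jf_sd_succ, jf_sd_two_of_flux hg]
  simp only [map_add, Derivation.leibniz, pd_zero_sd, smul_eq_mul]
  ring

lemma jf_sd_four_of_flux :
    jf (sd 4 g) = jf (sd 4 f) * jf (sd 2 h) + 3 * jf (sd 3 f) * jf (sd 3 h)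
      + 3 * jf (sd 2 f) * jf (sd 4 h) + jf (sd 1 f) * jf (sd 5 h) := by
  rw [jf_sd_succ, jf_sd_three_of_flux hg]
  simp only [map_add, Derivation.leibniz, derivation_ofNat, pd_zero_sd, smul_eq_mul]
  ring

lemma jf_sd_five_of_flux :
    jf (sd 5 g) = jf (sd 5 f) * jf (sd 2 h) + 4 * jf (sd 4 f) * jf (sd 3 h)
      + 6 * jf (sd 3 f) * jf (sd 4 h) + 4 * jf (sd 2 f) * jf (sd 5 h)
      + jf (sd 1 f) * jf (sd 6 h) := by
  rw [jf_sd_succ, jf_sd_four_of_flux hg]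
  simp only [map_add, Derivation.leibniz, derivation_ofNat, pd_zero_sd, smul_eq_mul]
  ring

lemma jf_sd_six_of_flux :
    jf (sd 6 g) = jf (sd 6 f) * jf (sd 2 h) + 5 * jf (sd 5 f) * jf (sd 3 h)
      + 10 * jf (sd 4 f) * jf (sd 4 h) + 10 * jf (sd 3 f) * jf (sd 5 h)
      + 5 * jf (sd 2 f) * jf (sd 6 h) + jf (sd 1 f) * jf (sd 7 h) := by
  rw [jf_sd_succ, jf_sd_five_of_flux hg]
  simp only [map_add, Derivation.leibniz, derivation_ofNat, pd_zero_sd, smul_eq_mul]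
  ring

end flux

/-- The coefficients agree with those of `D_{(c,p,s)}` of the leading one. -/
def IsDForm (c p s : smoothFun I) (a : Fin 4 → smoothFun I) : Prop :=
  cj a = cj (dForm c p s (a 0))

/-- After `β₀'''` is eliminated, the terms in `h''` and `h⁗` cancel. The factor that remains makes
`c α₀'` constant, and so leaves one free scale `k`. -/
lemma squareObs_dForm (ha : IsDForm c p s a) (hb : IsDForm c p s b)
    (hab : jf (sd 1 (b 0)) = jf (sd 1 (a 0)) * jf (sd 2 h)) :
    squareObs (cj a) (cj b) (cj (dForm c p s h)) =
      (1 / 2 : ℝ) • (pd 0 (jf (sd 0 c) * jf (sd 1 (a 0))) * jf (sd 3 h)) := by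
  rw [ha, hb]
  refine eq_of_ev fun q => ?_
  simp only [squareObs, map_add, map_sub, map_neg, map_mul, map_smul, ev_ofNat,
    smul_eq_mul, ev_dForm_one_zero, ev_dForm_one_one, ev_dForm_apply_zero, jf_sd_three_of_flux hab,
    Derivation.leibniz, pd_zero_sd, Nat.reduceAdd]
  ring

end JetSpace

/-! ### Derivatives of `1/c`. -/

namespace JetSpace

variable {I : Opens ℝ} {c p s h ci : smoothFun I} {a b : Fin 4 → smoothFun I}

lemma pd_zero_jf_eq (f : smoothFun I) : pd 0 (jf f) = jf (sd 1 f) := by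
  rw [jf_sd_succ, sd_zero]

section inverse

variable (hci : jf (sd 0 c) * jf ci = 1)
include hci

lemma pd_zero_inv : pd 0 (jf ci) = -jf (sd 1 c) * jf ci ^ 2 := by
  rw [Derivation.leibniz_of_mul_eq_one (pd 0) ((mul_comm _ _).trans hci), pd_zero_sd, smul_eq_mul]
  ring

lemma jf_sd_one_inv : jf (sd 1 ci) =
    -jf (sd 1 c) * jf ci ^ 2 := by
  rw [← pd_zero_jf_eq, pd_zero_inv hci]

lemma jf_sd_two_inv : jf (sd 2 ci) =
    2 * jf (sd 1 c) ^ 2 * jf ci ^ 3 - jf (sd 2 c) * jf ci ^ 2 := by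
  rw [jf_sd_succ, jf_sd_one_inv hci]
  simp only [map_neg, Derivation.leibniz, Derivation.leibniz_pow, pd_zero_sd,
    pd_zero_inv hci, smul_eq_mul, nsmul_eq_mul, Nat.cast_ofNat, Nat.reduceAdd, Nat.reduceSub, pow_one]
  ring

lemma jf_sd_three_inv : jf (sd 3 ci) =
    6 * jf (sd 1 c) * jf (sd 2 c) * jf ci ^ 3 - 6 * jf (sd 1 c) ^ 3 * jf ci ^ 4 - jf (sd 3 c) *
      jf ci ^ 2 := by
  rw [jf_sd_succ, jf_sd_two_inv hci]
  simp only [map_sub, Derivation.leibniz, Derivation.leibniz_pow, derivation_ofNat, pd_zero_sd,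
    pd_zero_inv hci, smul_eq_mul, nsmul_eq_mul, Nat.cast_ofNat, Nat.reduceAdd, Nat.reduceSub, pow_one]
  ring

lemma jf_sd_four_inv : jf (sd 4 ci) =
    8 * jf (sd 1 c) * jf (sd 3 c) * jf ci ^ 3 - 36 * jf (sd 1 c) ^ 2 * jf (sd 2 c) * jf ci ^ 4
      + 24 * jf (sd 1 c) ^ 4 * jf ci ^ 5 + 6 * jf (sd 2 c) ^ 2 * jf ci ^ 3 - jf (sd 4 c) *
      jf ci ^ 2 := by
  rw [jf_sd_succ, jf_sd_three_inv hci]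
  simp only [map_sub, Derivation.leibniz, Derivation.leibniz_pow, derivation_ofNat, pd_zero_sd,
    pd_zero_inv hci, smul_eq_mul, nsmul_eq_mul, Nat.cast_ofNat, Nat.reduceAdd, Nat.reduceSub, pow_one]
  ring

lemma jf_sd_five_inv : jf (sd 5 ci) =
    -90 * jf (sd 1 c) * jf (sd 2 c) ^ 2 * jf ci ^ 4 + 10 * jf (sd 1 c) * jf (sd 4 c) * jf ci ^ 3
      - 60 * jf (sd 1 c) ^ 2 * jf (sd 3 c) * jf ci ^ 4 + 240 * jf (sd 1 c) ^ 3 * jf (sd 2 c) *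
      jf ci ^ 5 - 120 * jf (sd 1 c) ^ 5 * jf ci ^ 6 + 20 * jf (sd 2 c) * jf (sd 3 c) * jf ci ^ 3
      - jf (sd 5 c) * jf ci ^ 2 := by
  rw [jf_sd_succ, jf_sd_four_inv hci]
  simp only [map_add, map_sub, Derivation.leibniz, Derivation.leibniz_pow, derivation_ofNat, pd_zero_sd,
    pd_zero_inv hci, smul_eq_mul, nsmul_eq_mul, Nat.cast_ofNat, Nat.reduceAdd, Nat.reduceSub, pow_one]
  ring

end inverse

end JetSpace

/-! ### The `u_xx²` and `u_x⁴` equations when `α₀' = k/c`. -/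

namespace JetSpace

variable {I : Opens ℝ} {c p s h ci : smoothFun I} {a b : Fin 4 → smoothFun I}

/-- The coefficient `e₀`, where `ci` stands for `1 / c`. -/
def gaugeForm (c s ci : smoothFun I) (lam : ℝ) : smoothFun I :=
  (1 / 2 : ℝ) • ((53 / 24 : ℝ) • (sd 2 c * sd 1 c ^ 2 * ci ^ 2)
    - (8 / 15 : ℝ) • (sd 1 c ^ 4 * ci ^ 3) + sd 1 s * ci
    - (157 / 120 : ℝ) • (sd 2 c ^ 2 * ci) - (5 : ℝ) • (sd 0 s * sd 1 c * ci ^ 2)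
    - (173 / 120 : ℝ) • (sd 1 c * sd 3 c * ci) + (5 / 12 : ℝ) • sd 4 c
    + lam • ((-(13 / 2) : ℝ) • (sd 2 c * sd 1 c) + (2 : ℝ) • (sd 1 c ^ 3 * ci)
      + (11 / 6 : ℝ) • (sd 0 c * sd 3 c)))

lemma jf_sd_smul_of_eq {f g : smoothFun I} {k : ℝ} (hfg : jf (sd 1 f) = k • jf g) (n : ℕ) :
    jf (sd (n + 1) f) = k • jf (sd n g) := by
  induction n with
  | zero => rw [hfg, sd_zero]
  | succ n ih => rw [jf_sd_succ, ih, Derivation.map_smul, pd_zero_sd]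

section inverse

variable (hci : jf (sd 0 c) * jf ci = 1) {k : ℝ} (hk : jf (sd 1 (a 0)) = k • jf ci)
include hci hk

/-- All terms in `h''`, `h⁗` and `h⁽⁵⁾` cancel, and what multiplies `h'''` is a total `u`-derivative
up to the factor `c²`. The relation between `p` and `c` is its first integral. -/
lemma bendObs_dForm (ha : IsDForm c p s a) (hb : IsDForm c p s b)
    (hab : jf (sd 1 (b 0)) = jf (sd 1 (a 0)) * jf (sd 2 h)) :
    bendObs (cj a) (cj b) (cj (dForm c p s h)) =
      (-6 * k) • (jf (sd 0 c) ^ 2 * pd 0 (jf (sd 0 p) * jf ci ^ 3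
        - (3 / 5 : ℝ) • (jf (sd 1 c) * jf ci ^ 2)) * jf (sd 3 h)) := by
  have hka := jf_sd_smul_of_eq hk
  rw [ha, hb]
  -- The jet algebra is not a field. At a fixed jet the identity is one between real numbers, where
  -- `c` can be replaced by the inverse of the value of `ci` and denominators cleared.
  refine eq_of_ev fun q => ?_
  have hq := congrArg (ev q) hci
  simp only [map_mul, map_one] at hq
  have hq' : ev q (jf (sd 0 c)) = (ev q (jf ci))⁻¹ := eq_inv_of_mul_eq_one_left hq
  have hq0 : ev q (jf ci) ≠ 0 := right_ne_zero_of_mul_eq_one hq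
  simp only [bendObs, map_add, map_sub, map_neg, map_mul, map_pow, map_smul, ev_ofNat, smul_eq_mul,
    nsmul_eq_mul, Nat.cast_ofNat, Nat.reduceAdd, ev_dForm_one_zero, ev_dForm_three_zero, ev_dForm_three_one,
    ev_dForm_apply_zero, jf_sd_three_of_flux hab, jf_sd_four_of_flux hab, hka 0, hka 1, hka 2, hka 3,
    Derivation.map_smul, Derivation.leibniz, Derivation.leibniz_pow, pd_zero_sd,
    pd_zero_inv hci, jf_sd_one_inv hci, jf_sd_two_inv hci, jf_sd_three_inv hci]
  simp only [sd_zero] at hq' ⊢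
  rw [hq']
  field_simp
  ring

/-- This is where `e₀` comes from: `e` enters only through `12 e h'''`, and once `p`, `p'`, `p''`
are expressed by `c` and `λ` the other terms collapse to `-12 k e₀ h'''`. -/
lemma quarticObs_dForm {lam : ℝ} {e : smoothFun I}
    (hp : jf p = (3 / 5 : ℝ) • (jf (sd 0 c) * jf (sd 1 c)) + lam • jf (sd 0 c) ^ 3)
    (ha : IsDForm c p s a) (hb : IsDForm c p s b)
    (hab : jf (sd 1 (b 0)) = jf (sd 1 (a 0)) * jf (sd 2 h)) :
    quarticObs (cj a) (cj b) (cj (dForm c p s h)) (fun n => jf (sd n e)) =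
      (12 : ℝ) • ((jf e - k • jf (gaugeForm c s ci lam)) * jf (sd 3 h)) := by
  have hka := jf_sd_smul_of_eq hk
  have hp1 : jf (sd 1 p) = (3 / 5 : ℝ) • (jf (sd 1 c) ^ 2 + jf (sd 0 c) * jf (sd 2 c))
      + (3 * lam) • (jf (sd 0 c) ^ 2 * jf (sd 1 c)) := by
    rw [← pd_zero_jf_eq, hp]
    simp only [map_add, Derivation.map_smul, Derivation.leibniz, Derivation.leibniz_pow, pd_zero_sd,
      smul_eq_mul, nsmul_eq_mul, Nat.cast_ofNat, Nat.reduceAdd, Nat.reduceSub]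
    simp only [Algebra.smul_def, map_mul, map_ofNat]
    ring
  have hp2 : jf (sd 2 p) = (3 / 5 : ℝ) • (3 * (jf (sd 1 c) * jf (sd 2 c))
      + jf (sd 0 c) * jf (sd 3 c))
      + (3 * lam) • (2 * (jf (sd 0 c) * jf (sd 1 c) ^ 2) + jf (sd 0 c) ^ 2 * jf (sd 2 c)) := by
    rw [jf_sd_succ, hp1]
    simp only [map_add, Derivation.map_smul, Derivation.leibniz, Derivation.leibniz_pow, pd_zero_sd,
      smul_eq_mul, nsmul_eq_mul, Nat.cast_ofNat, Nat.reduceAdd, Nat.reduceSub, pow_one]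
    simp only [Algebra.smul_def, map_mul, map_ofNat]
    ring
  rw [ha, hb]
  refine eq_of_ev fun q => ?_
  have hq := congrArg (ev q) hci
  simp only [map_mul, map_one] at hq
  have hq' : ev q (jf (sd 0 c)) = (ev q (jf ci))⁻¹ := eq_inv_of_mul_eq_one_left hq
  have hq0 : ev q (jf ci) ≠ 0 := right_ne_zero_of_mul_eq_one hq
  simp only [quarticObs, gaugeForm, map_add, map_sub, map_neg, map_mul, map_pow, map_smul, ev_ofNat,
    smul_eq_mul, ev_dForm_one_zero, ev_dForm_one_one,
    ev_dForm_one_two, ev_dForm_two_zero, ev_dForm_two_one, ev_dForm_three_zero, ev_dForm_three_one,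
    ev_dForm_apply_zero, jf_sd_three_of_flux hab, jf_sd_four_of_flux hab, jf_sd_five_of_flux hab,
    jf_sd_six_of_flux hab, hka 0, hka 1, hka 2, hka 3, hka 4, hka 5, hp1, hp2, sd_zero, hp,
    jf_sd_one_inv hci, jf_sd_two_inv hci, jf_sd_three_inv hci, jf_sd_four_inv hci,
    jf_sd_five_inv hci]
  simp only [sd_zero] at hq'
  rw [hq']
  field_simp
  ring

end inverse

end JetSpace

/-! ### Solution of the system. -/

namespace JetSpace

variable {I : Opens ℝ} {c p s h ci e e' : smoothFun I} {a b a' b' : Fin 4 → smoothFun I}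

lemma isDForm_of_jf_eq (h1 : jf (a 1) = jf (dForm c p s (a 0) 1))
    (h2 : jf (a 2) = jf (dForm c p s (a 0) 2)) (h3 : jf (a 3) = jf (dForm c p s (a 0) 3)) :
    IsDForm c p s a := by
  funext i
  fin_cases i
  exacts [rfl, funext (jf_sd_congr h1), funext (jf_sd_congr h2), funext (jf_sd_congr h3)]

lemma IsDForm.jf_eq (ha : IsDForm c p s a) (i : Fin 4) : jf (a i) = jf (dForm c p s (a 0) i) := by
  rw [← cj_zero, ← cj_zero, ← ha]

lemma IsDForm.cubicObs_eq_zero (ha : IsDForm c p s a) :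
    cubicObs (cj a) (cj (dForm c p s h)) = 0 := by
  rw [cubicObs_dForm, ha.jf_eq 1, sub_self, zero_mul]

lemma IsDForm.mixedObs_eq_zero (ha : IsDForm c p s a) :
    mixedObs (cj a) (cj (dForm c p s h)) = 0 := by
  rw [mixedObs_dForm (ha.jf_eq 1), ha.jf_eq 3, sub_self, zero_mul, smul_zero]

lemma IsDForm.quinticObs_eq_zero (ha : IsDForm c p s a) :
    quinticObs (cj a) (cj (dForm c p s h)) = 0 := by
  rw [quinticObs_dForm (ha.jf_eq 1) (ha.jf_eq 3), ha.jf_eq 2, sub_self, zero_mul, smul_zero]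

section necessity

variable (hdiv : ∀ f : smoothFun I, jf f * jf (sd 3 h) = 0 → jf f = 0)
include hdiv

/-- The coefficients are found in the order `a₁`, `a₃`, `a₂`: the `u_x u_xx²` equation factors only
once `a₁` is known, and the `u_x⁵` equation only once `a₁` and `a₃` are. -/
lemma isDForm_of_obs_eq_zero (h1 : cubicObs (cj a) (cj (dForm c p s h)) = 0)
    (h2 : mixedObs (cj a) (cj (dForm c p s h)) = 0)
    (h3 : quinticObs (cj a) (cj (dForm c p s h)) = 0) : IsDForm c p s a := by
  have hdiv' : ∀ f g : smoothFun I, (jf f - jf g) * jf (sd 3 h) = 0 → jf f = jf g := fun f g hfg => by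
    rw [← map_sub] at hfg
    have := hdiv _ hfg
    rwa [map_sub, sub_eq_zero] at this
  rw [cubicObs_dForm] at h1
  have ha1 := hdiv' _ _ h1
  rw [mixedObs_dForm ha1, smul_eq_zero_iff_right (by norm_num)] at h2
  have ha3 := hdiv' _ _ h2
  rw [quinticObs_dForm ha1 ha3, smul_eq_zero_iff_right (by norm_num)] at h3
  exact isDForm_of_jf_eq ha1 (hdiv' _ _ h3) ha3

variable (hconst : ∀ f : smoothFun I, jf (sd 1 f) = 0 → ∃ k : ℝ, jf f = algebraMap ℝ _ k)
  (hci : jf (sd 0 c) * jf ci = 1)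
include hconst hci

lemma exists_const_of_squareObs_eq_zero (ha : IsDForm c p s a) (hb : IsDForm c p s b)
    (hab : jf (sd 1 (b 0)) = jf (sd 1 (a 0)) * jf (sd 2 h))
    (h0 : squareObs (cj a) (cj b) (cj (dForm c p s h)) = 0) :
    ∃ k : ℝ, jf (sd 1 (a 0)) = k • jf ci := by
  rw [squareObs_dForm ha hb hab, smul_eq_zero_iff_right (by norm_num), ← map_mul, pd_zero_jf_eq] at h0
  obtain ⟨k, hk⟩ := hconst _ (hdiv _ h0)
  refine ⟨k, ?_⟩
  rw [map_mul] at hk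
  rw [Algebra.smul_def, ← hk]
  linear_combination (-jf (sd 1 (a 0))) * hci

/-- No relation between `p` and `c` is assumed, so this is available both for deriving that relation
and for classifying the solutions under it. -/
lemma StringEquations.necessary
    (H : StringEquations (cj a) (cj b) (cj (dForm c p s h)) (fun n => jf (sd n e))) :
    IsDForm c p s a ∧ IsDForm c p s b ∧ jf (sd 1 (b 0)) = jf (sd 1 (a 0)) * jf (sd 2 h) ∧
      ∃ k : ℝ, jf (sd 1 (a 0)) = k • jf ci := by
  have ha := isDForm_of_obs_eq_zero hdiv H.cubic_left H.mixed_left H.quintic_left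
  have hb := isDForm_of_obs_eq_zero hdiv H.cubic_right H.mixed_right H.quintic_right
  have hab : jf (sd 1 (b 0)) = jf (sd 1 (a 0)) * jf (sd 2 h) := sub_eq_zero.1 H.flux
  exact ⟨ha, hb, hab, exists_const_of_squareObs_eq_zero hdiv hconst hci ha hb hab H.square⟩

/-- A conserved quantity with `k ≠ 0` forces the relation between `p` and `c`. -/
lemma StringEquations.exists_relation
    (H : StringEquations (cj a) (cj b) (cj (dForm c p s h)) (fun n => jf (sd n e)))
    {k : ℝ} (hk0 : k ≠ 0) (hk : jf (sd 1 (a 0)) = k • jf ci) :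
    ∃ lam : ℝ, jf p = (3 / 5 : ℝ) • (jf (sd 0 c) * jf (sd 1 c)) + lam • jf (sd 0 c) ^ 3 := by
  obtain ⟨ha, hb, hab, -⟩ := H.necessary hdiv hconst hci
  have h0 := H.bend
  rw [bendObs_dForm hci hk ha hb hab, smul_eq_zero_iff_right (mul_ne_zero (by norm_num) hk0)] at h0
  have h1 : jf (sd 0 p * ci ^ 3 - (3 / 5 : ℝ) • (sd 1 c * ci ^ 2)) =
      jf (sd 0 p) * jf ci ^ 3 - (3 / 5 : ℝ) • (jf (sd 1 c) * jf ci ^ 2) := by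
    simp only [map_sub, map_mul, map_pow, map_smul]
  rw [← h1, pd_zero_jf_eq, ← map_pow, ← map_mul] at h0
  have h2 := hdiv _ h0
  rw [map_mul, map_pow] at h2
  -- Multiplication by `ci ^ 2` removes the factor `c²`.
  have h3 : jf (sd 1 (sd 0 p * ci ^ 3 - (3 / 5 : ℝ) • (sd 1 c * ci ^ 2))) = 0 := by
    have := congrArg (fun m => jf ci ^ 2 * m) h2
    simp only [mul_zero] at this
    rw [← this, ← mul_assoc, ← mul_pow, mul_comm (jf ci), hci, one_pow, one_mul]
  obtain ⟨lam, hlam⟩ := hconst _ h3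
  refine ⟨lam, ?_⟩
  rw [h1, sd_zero, Algebra.smul_def] at hlam
  rw [Algebra.smul_def, Algebra.smul_def, ← hlam]
  have hc3 : jf (sd 0 c) ^ 3 * jf ci ^ 3 = 1 := by rw [← mul_pow, hci, one_pow]
  have hc2 : jf (sd 0 c) ^ 2 * jf ci ^ 2 = 1 := by rw [← mul_pow, hci, one_pow]
  linear_combination (-jf p) * hc3
    + algebraMap ℝ (jetAlgebra I) (3 / 5) * jf (sd 0 c) * jf (sd 1 c) * hc2

end necessity

lemma jf_sd_succ_eq_zero {f : smoothFun I} (hf : jf (sd 1 f) = 0) (n : ℕ) :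
    jf (sd (n + 1) f) = 0 := by
  induction n with
  | zero => exact hf
  | succ n ih => rw [jf_sd_succ, ih, map_zero]

/-- Beyond its leading term `D(f)` involves only derivatives of `f` of order at least three. With
`α₀` and `β₀` locally constant the `u_x⁴` equation therefore reduces to `12 e h''' = 0`, whatever
`p` is. -/
lemma StringEquations.jf_eq_zero
    (hdiv : ∀ f : smoothFun I, jf f * jf (sd 3 h) = 0 → jf f = 0)
    (ha : IsDForm c p s a) (hb : IsDForm c p s b) (ha0 : jf (sd 1 (a 0)) = 0)
    (hb0 : jf (sd 1 (b 0)) = 0)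
    (H : StringEquations (cj a) (cj b) (cj (dForm c p s h)) (fun n => jf (sd n e))) :
    jf e = 0 := by
  have hz : ∀ f : Fin 4 → smoothFun I, IsDForm c p s f → jf (sd 1 (f 0)) = 0 →
      (∀ n, cj f 0 (n + 1) = 0) ∧ ∀ i n, i ≠ 0 → cj f i n = 0 := by
    intro f hf hf0
    have h0 := jf_sd_succ_eq_zero hf0
    refine ⟨h0, fun i n hi => ?_⟩
    have hi0 : jf (f i) = jf 0 := by
      rw [hf.jf_eq]
      fin_cases i
      · exact absurd rfl hi
      all_goals simp [dForm, h0 2, h0 3, h0 4, h0 5]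
    rw [cj, jf_sd_congr hi0]
    exact JetSpace.jf_eq_zero fun v _ => by simp
  have h0 := H.quartic
  simp only [quarticObs, (hz a ha ha0).2 _ _ (by decide : (1 : Fin 4) ≠ 0),
    (hz a ha ha0).2 _ _ (by decide : (2 : Fin 4) ≠ 0),
    (hz a ha ha0).2 _ _ (by decide : (3 : Fin 4) ≠ 0),
    (hz b hb hb0).2 _ _ (by decide : (2 : Fin 4) ≠ 0), (hz a ha ha0).1 0, (hz a ha ha0).1 1,
    (hz a ha ha0).1 2, (hz a ha ha0).1 3, zero_mul, mul_zero, sub_zero, add_zero,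
    zero_add, sd_zero] at h0
  refine hdiv e ?_
  have h12 : (12 : ℝ) • (jf e * jf (sd 3 h)) = 0 := by
    rw [Algebra.smul_def, map_ofNat, ← mul_assoc]
    exact h0
  exact (smul_eq_zero_iff_right (by norm_num)).1 h12

/-- Under the relation between `p` and `c`, the conserved quantities are the multiples of
the one given by `D_{(c,p,s)}(r)`, `D_{(c,p,s)}(q)` and `e₀`. -/
theorem stringEquations_dForm_iff {lam : ℝ}
    (hdiv : ∀ f : smoothFun I, jf f * jf (sd 3 h) = 0 → jf f = 0)
    (hconst : ∀ f : smoothFun I, jf (sd 1 f) = 0 → ∃ k : ℝ, jf f = algebraMap ℝ _ k)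
    (hci : jf (sd 0 c) * jf ci = 1)
    (hp : jf p = (3 / 5 : ℝ) • (jf (sd 0 c) * jf (sd 1 c)) + lam • jf (sd 0 c) ^ 3) :
    StringEquations (cj a) (cj b) (cj (dForm c p s h)) (fun n => jf (sd n e)) ↔
      IsDForm c p s a ∧ IsDForm c p s b ∧ ∃ k : ℝ, jf (sd 1 (a 0)) = k • jf ci ∧
        jf (sd 1 (b 0)) = k • (jf (sd 2 h) * jf ci) ∧ jf e = k • jf (gaugeForm c s ci lam) := by
  constructor
  · intro H
    obtain ⟨ha, hb, hab, k, hk⟩ := H.necessary hdiv hconst hci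
    refine ⟨ha, hb, k, hk, ?_, ?_⟩
    · rw [hab, hk, smul_mul_assoc, mul_comm]
    · have h0 := H.quartic
      rw [quarticObs_dForm hci hk hp ha hb hab, smul_eq_zero_iff_right (by norm_num), ← map_smul,
        ← map_sub] at h0
      have := hdiv _ h0
      rwa [map_sub, map_smul, sub_eq_zero] at this
  · rintro ⟨ha, hb, k, hk, hbk, he⟩
    have hab : jf (sd 1 (b 0)) = jf (sd 1 (a 0)) * jf (sd 2 h) := by
      rw [hbk, hk, smul_mul_assoc, mul_comm]
    -- The relation on `p` says that this first integral equals `λ`.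
    have hpd : pd 0 (jf (sd 0 p) * jf ci ^ 3 - (3 / 5 : ℝ) • (jf (sd 1 c) * jf ci ^ 2)) = 0 := by
      have : jf (sd 0 p) * jf ci ^ 3 - (3 / 5 : ℝ) • (jf (sd 1 c) * jf ci ^ 2) =
          algebraMap ℝ _ lam := by
        have hc3 : jf (sd 0 c) ^ 3 * jf ci ^ 3 = 1 := by rw [← mul_pow, hci, one_pow]
        rw [sd_zero p, hp, Algebra.smul_def, Algebra.smul_def, Algebra.smul_def]
        linear_combination algebraMap ℝ (jetAlgebra I) lam * hc3
          + algebraMap ℝ (jetAlgebra I) (3 / 5) * jf (sd 1 c) * jf ci ^ 2 * hci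
      rw [this, Derivation.map_algebraMap]
    exact {
      flux := sub_eq_zero.2 hab
      square := by
        rw [squareObs_dForm ha hb hab, hk, mul_smul_comm, hci, Derivation.map_smul,
          Derivation.map_one_eq_zero, smul_zero, zero_mul, smul_zero]
      cubic_left := ha.cubicObs_eq_zero
      cubic_right := hb.cubicObs_eq_zero
      bend := by
        rw [bendObs_dForm hci hk ha hb hab, hpd, mul_zero, zero_mul, smul_zero]
      quartic := by
        rw [quarticObs_dForm hci hk hp ha hb hab, he, sub_self, zero_mul, smul_zero]
      mixed_left := ha.mixedObs_eq_zero
      quintic_left := ha.quinticObs_eq_zero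
      mixed_right := hb.mixedObs_eq_zero
      quintic_right := hb.quinticObs_eq_zero }

/-- Leading coefficients are compared only through their derivatives, since additive constants are
free; neither the higher coefficients of `D` nor the variational derivative sees them. -/
lemma IsDForm.cj_eq_smul {K : ℝ} (ha : IsDForm c p s a) (ha' : IsDForm c p s a')
    (h0 : jf (sd 1 (a 0)) = K • jf (sd 1 (a' 0))) :
    (∀ n, cj a 0 (n + 1) = K • cj a' 0 (n + 1)) ∧ ∀ i n, i ≠ 0 → cj a i n = K • cj a' i n := by
  have hs : ∀ n, jf (sd (n + 1) (a 0)) = K • jf (sd (n + 1) (a' 0)) := fun n => by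
    induction n with
    | zero => exact h0
    | succ n ih => rw [jf_sd_succ, ih, Derivation.map_smul, pd_zero_sd]
  refine ⟨hs, fun i n hi => ?_⟩
  have hi0 : jf (a i) = jf (K • a' i) := by
    rw [ha.jf_eq, map_smul, ha'.jf_eq]
    fin_cases i
    · exact absurd rfl hi
    all_goals
      simp only [dForm, Fin.mk_one, Fin.reduceFinMk, Matrix.cons_val, map_mul, map_add,
        map_sub, map_pow, hs 2, hs 3, hs 4, hs 5, Algebra.smul_def]
      ring
  have hsm : ∀ n, jf (sd n (K • a' i)) = K • jf (sd n (a' i)) := fun n => by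
    induction n with
    | zero => rw [sd_zero, sd_zero, map_smul]
    | succ n ih => rw [jf_sd_succ, ih, Derivation.map_smul, pd_zero_sd]
  rw [cj, jf_sd_congr hi0, hsm, cj]

/-- Proportional coefficients give proportional variational derivatives. -/
lemma el_stringJet_eq_smul {K : ℝ} (ha : IsDForm c p s a) (hb : IsDForm c p s b)
    (ha' : IsDForm c p s a') (hb' : IsDForm c p s b')
    (ha0 : jf (sd 1 (a 0)) = K • jf (sd 1 (a' 0))) (hb0 : jf (sd 1 (b 0)) = K • jf (sd 1 (b' 0)))
    (he : jf e = K • jf e') (ε : ℝ) :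
    el (stringJet a b e ε) = K • el (stringJet a' b' e' ε) := by
  obtain ⟨hA0, hA⟩ := ha.cj_eq_smul ha' ha0
  obtain ⟨hB0, hB⟩ := hb.cj_eq_smul hb' hb0
  have he1 : jf (sd 1 e) = K • jf (sd 1 e') := by
    rw [← pd_zero_jf_eq, he, Derivation.map_smul, pd_zero_jf_eq]
  rw [el_stringJet, el_stringJet]
  simp only [stringTwo, stringFour, hA0 0, hB0 0, hA 1 _ (by decide), hA 2 _ (by decide),
    hA 3 _ (by decide), hB 1 _ (by decide), hB 2 _ (by decide), hB 3 _ (by decide), sd_zero, he, he1,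
    Algebra.smul_def]
  ring

end JetSpace

/-! ### Analysis on `I`, and passage from the given functions to the jet algebra. -/

namespace JetSpace

variable {I : Opens ℝ} {c p s h ci e e' : smoothFun I} {a b a' b' : Fin 4 → smoothFun I}

lemma jf_eq_iff {f g : smoothFun I} : jf f = jf g ↔ ∀ v ∈ I, f.1 v = g.1 v := by
  rw [← sub_eq_zero, ← map_sub, jf_eq_zero_iff]
  simp [sub_eq_zero]

lemma exists_jf_eq_const (hI : IsPreconnected (I : Set ℝ)) (f : smoothFun I)
    (hf : jf (sd 1 f) = 0) : ∃ k : ℝ, jf f = algebraMap ℝ _ k := by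
  have hf' : ∀ v ∈ I, deriv f.1 v = 0 := fun v hv => by
    have := jf_eq_zero_iff.1 hf v hv
    rwa [sd_coe, iteratedDeriv_one] at this
  rcases (I : Set ℝ).eq_empty_or_nonempty with h0 | ⟨v₀, hv₀⟩
  · refine ⟨0, eq_of_ev fun q => ?_⟩
    have : q.1.2.2 0 ∈ (I : Set ℝ) := q.2
    simp [h0] at this
  · refine ⟨f.1 v₀, eq_of_ev fun q => ?_⟩
    rw [ev_jf, AlgHom.commutes]
    exact I.2.is_const_of_deriv_eq_zero hI (f.2.differentiableOn (by simp))
      (fun v hv => hf' v hv) q.2 hv₀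

/-- If `f v ≠ 0`, continuity keeps `f` nonzero near `v`, and density provides a nearby point where
`h''' ≠ 0` too. The set where `h''' = 0` has empty interior but may be large, so pointwise division
is not possible. -/
lemma jf_eq_zero_of_mul_eq_zero (hh : (I : Set ℝ) ⊆ closure {v ∈ I | iteratedDeriv 3 h.1 v ≠ 0})
    (f : smoothFun I) (hf : jf f * jf (sd 3 h) = 0) : jf f = 0 := by
  rw [← map_mul, jf_eq_zero_iff] at hf
  refine jf_eq_zero fun v hv => ?_
  by_contra hne
  have hcont : ContinuousAt f.1 v := f.2.continuousOn.continuousAt (I.2.mem_nhds hv)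
  obtain ⟨w, ⟨hw, hw3⟩, hfw⟩ :=
    ((mem_closure_iff_frequently.1 (hh hv)).and_eventually (hcont.eventually_ne hne)).exists
  rcases mul_eq_zero.1 (hf w hw) with h0 | h0
  exacts [hfw h0, hw3 h0]

lemma restrict_dOp (c p s h : smoothFun I) (ε : ℝ) :
    restrict I (dOp c p s h ε) = normalJet (dForm c p s h) ε := by
  funext q
  rw [← ev_apply]
  simp only [normalJet, dForm, sd_zero, Matrix.cons_val, map_add, map_smul, map_mul, map_pow,
    map_sub, ev_ju, ev_jf, sd_coe, iteratedDeriv_one, smul_eq_mul, restrict, dOp, coefC, coefS,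
    coefP]
  ring

end JetSpace

namespace StringForm

variable {I : Opens ℝ} {N : StringForm}

open JetSpace

/-- The coefficients of `α` as smooth functions on `I`. -/
def alphaCoef (hN : N.SmoothOn I) : Fin 4 → smoothFun I :=
  ![⟨N.α₀, hN.1.1⟩, ⟨N.α₁, hN.1.2.1⟩, ⟨N.α₂, hN.1.2.2.1⟩, ⟨N.α₃, hN.1.2.2.2⟩]

/-- The coefficients of `β` as smooth functions on `I`. -/
def betaCoef (hN : N.SmoothOn I) : Fin 4 → smoothFun I :=
  ![⟨N.β₀, hN.2.1.1⟩, ⟨N.β₁, hN.2.1.2.1⟩, ⟨N.β₂, hN.2.1.2.2.1⟩, ⟨N.β₃, hN.2.1.2.2.2⟩]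

/-- The coefficient `e` as a smooth function on `I`. -/
def eCoef (hN : N.SmoothOn I) : smoothFun I := ⟨N.e, hN.2.2⟩

lemma restrict_alpha (hN : N.SmoothOn I) (ε : ℝ) :
    restrict I (N.alpha ε) = normalJet (alphaCoef hN) ε := by
  funext q
  rw [← ev_apply]
  simp [normalJet, alphaCoef, sd_zero, restrict, alpha]
  ring

lemma restrict_beta (hN : N.SmoothOn I) (ε : ℝ) :
    restrict I (N.beta ε) = normalJet (betaCoef hN) ε := by
  funext q
  rw [← ev_apply]
  simp [normalJet, betaCoef, sd_zero, restrict, beta]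
  ring

lemma restrict_density (hN : N.SmoothOn I) (ε : ℝ) :
    restrict I (N.density ε) = stringJet (alphaCoef hN) (betaCoef hN) (eCoef hN) ε := by
  funext q
  have h1 := congrFun (restrict_alpha hN ε) q
  have h2 := congrFun (restrict_beta hN ε) q
  rw [← ev_apply] at h1 h2 ⊢
  simp only [stringJet, map_add, map_mul, map_smul, ← h1, ← h2]
  simp [restrict, density, eCoef, sd_zero]

end StringForm

/-! ### Comparison with multiples of `D(r)`, and primitives on `I`. -/

namespace JetSpace

variable {I : Opens ℝ} {c p s h ci f g : smoothFun I} {a b : Fin 4 → smoothFun I}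

lemma jf_dForm_eq_smul {k : ℝ} (hfg : jf f = k • jf g) (i : Fin 4) :
    jf (dForm c p s f i) = k • jf (dForm c p s g i) := by
  have hs : ∀ n, jf (sd n f) = k • jf (sd n g) := fun n => by
    induction n with
    | zero => rwa [sd_zero, sd_zero]
    | succ n ih => rw [jf_sd_succ, ih, Derivation.map_smul, pd_zero_sd]
  fin_cases i
  · exact hfg
  all_goals
    simp only [dForm, Fin.mk_one, Fin.reduceFinMk, Matrix.cons_val, map_mul, map_add,
      map_sub, map_pow, hs, Algebra.smul_def]
    ring

lemma normalJet_eq_smul_iff {k : ℝ} :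
    (∀ ε, normalJet a ε = k • normalJet b ε) ↔ ∀ i, jf (a i) = k • jf (b i) := by
  constructor
  · intro H
    have hv : ∀ v ∈ I, ∀ ε y z : ℝ,
        (a 0).1 v + ε ^ 2 * ((a 1).1 v * y ^ 2) + ε ^ 4 * ((a 2).1 v * y ^ 4 + (a 3).1 v * z ^ 2) =
        k * ((b 0).1 v + ε ^ 2 * ((b 1).1 v * y ^ 2)
          + ε ^ 4 * ((b 2).1 v * y ^ 4 + (b 3).1 v * z ^ 2)) := fun v hv ε y z => by
      have := congrArg (ev ⟨(0, 0, fun n => if n = 0 then v else if n = 1 then y else z), hv⟩) (H ε)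
      simpa [normalJet, sd_zero, mul_add] using this
    intro i
    rw [← map_smul, jf_eq_iff]
    intro v hvI
    -- Four choices of `(ε, u_x, u_xx)` separate the coefficients: the first gives the leading one,
    -- the two with `u_x = 1, 2` separate `u_x²` from `u_x⁴`, and the last gives that of `u_xx²`.
    have h0 := hv v hvI 0 0 0
    have h1 := hv v hvI 1 1 0
    have h2 := hv v hvI 1 2 0
    have h3 := hv v hvI 1 0 1
    change (a i).1 v = k * (b i).1 v
    fin_cases i <;> simp only [Fin.zero_eta, Fin.mk_one, Fin.reduceFinMk] <;> linarith
  · intro H ε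
    simp only [normalJet, sd_zero, H, Algebra.smul_def]
    ring

lemma normalJet_eq_smul_dForm_iff {k : ℝ} :
    (∀ ε, normalJet a ε = k • normalJet (dForm c p s f) ε) ↔
      IsDForm c p s a ∧ jf (a 0) = k • jf f := by
  rw [normalJet_eq_smul_iff]
  refine ⟨fun H => ?_, fun ⟨ha, h0⟩ i => by rw [ha.jf_eq, jf_dForm_eq_smul h0]⟩
  have h0 : jf (a 0) = k • jf f := H 0
  have hi : ∀ i, jf (a i) = jf (dForm c p s (a 0) i) := fun i => by
    rw [H i, jf_dForm_eq_smul h0]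
  exact ⟨isDForm_of_jf_eq (hi 1) (hi 2) (hi 3), h0⟩

lemma ext_jet {F G : Density} {k : ℝ} {m n : jetAlgebra I} (hF : restrict I F = m)
    (hG : restrict I G = n) :
    (∀ (x t : ℝ) (j : ℕ → ℝ), j 0 ∈ I → F x t j = k * G x t j) ↔ m = k • n := by
  constructor
  · rintro H
    refine eq_of_ev fun q => ?_
    rw [map_smul, ev_apply, ev_apply, ← hF, ← hG]
    exact H _ _ _ q.2
  · intro H x t j hj
    have := congrArg (ev ⟨(x, t, j), hj⟩) H
    rwa [map_smul, ev_apply, ev_apply, ← hF, ← hG] at this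

lemma hasDerivAt_of_mem (f : smoothFun I) {v : ℝ} (hv : v ∈ I) :
    HasDerivAt f.1 ((sd 1 f).1 v) v := by
  rw [sd_coe, iteratedDeriv_one]
  exact (f.2.differentiableOn (by simp)).hasDerivAt (I.2.mem_nhds hv)

lemma isGenerator_iff {r q : smoothFun I} (hci : ∀ v ∈ I, ci.1 v = (c.1 v)⁻¹) :
    IsGenerator h c r q I ↔ jf (sd 1 r) = jf ci ∧ jf (sd 1 q) = jf (sd 2 h) * jf ci := by
  rw [← map_mul, jf_eq_iff, jf_eq_iff, ← forall₂_and]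
  refine forall₂_congr fun v hv => ?_
  have hu : ∀ (g : smoothFun I) (y : ℝ), HasDerivAt g.1 y v ↔ (sd 1 g).1 v = y := fun g y =>
    ⟨fun h => (hasDerivAt_of_mem g hv).unique h, fun h => h ▸ hasDerivAt_of_mem g hv⟩
  rw [hu, hu, one_div, ← hci v hv, div_eq_mul_inv, ← hci v hv, ← sd_coe]
  rfl

/-- Generators are specified only by their first derivatives; this makes them smooth, so that `D`
applies to them in the jet algebra. -/
lemma contDiffOn_of_hasDerivAt {r : ℝ → ℝ} (hr : ∀ v ∈ I, HasDerivAt r (f.1 v) v) :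
    ContDiffOn ℝ ∞ r I :=
  (contDiffOn_infty_iff_deriv_of_isOpen I.2).2
    ⟨fun v hv => (hr v hv).differentiableAt.differentiableWithinAt,
      f.2.congr fun v hv => (hr v hv).deriv⟩

lemma exists_primitive (hI : IsConnected (I : Set ℝ)) (f : smoothFun I) :
    ∃ r : ℝ → ℝ, ∀ v ∈ I, HasDerivAt r (f.1 v) v := by
  obtain ⟨v₀, hv₀⟩ := hI.nonempty
  have hcont : ContinuousOn f.1 I := f.2.continuousOn
  refine ⟨fun v => ∫ y in v₀..v, f.1 y, fun v hv => ?_⟩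
  exact intervalIntegral.integral_hasDerivAt_right
    (hcont.mono (hI.isPreconnected.ordConnected.uIcc_subset hv₀ hv)).intervalIntegrable
    (hcont.stronglyMeasurableAtFilter I.2 v hv) (hcont.continuousAt (I.2.mem_nhds hv))

lemma gaugeForm_apply {lam v : ℝ} (hv : v ∈ I) (hci : ∀ v ∈ I, ci.1 v = (c.1 v)⁻¹) :
    (gaugeForm c s ci lam).1 v = gaugeE c s lam v := by
  have : (gaugeForm c s ci lam).1 v =
      ev (I := I) ⟨(0, 0, fun _ => v), hv⟩ (jf (gaugeForm c s ci lam)) := rfl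
  rw [this]
  simp only [gaugeForm, gaugeE, map_add, map_sub, map_mul, map_pow, map_smul, ev_jf, sd_coe,
    iteratedDeriv_one, iteratedDeriv_zero, smul_eq_mul, hci v hv, div_eq_mul_inv]
  ring

end JetSpace

/-! ### String forms: conservation, nonvanishing and the generated solution. -/

namespace StringForm

open JetSpace

variable {I : Opens ℝ} {N M : StringForm} {c p s h ci : smoothFun I}

lemma isConservedUpTo_iff_stringEquations (hN : N.SmoothOn I) :
    IsConservedUpTo I 6 (hamFlow h c p s) N.density ↔
      StringEquations (cj (alphaCoef hN)) (cj (betaCoef hN)) (cj (dForm c p s h))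
        (fun n => jf (sd n (eCoef hN))) :=
  isConservedUpTo_iff (restrict_density hN) (restrict_dOp c p s h)

lemma isDOpForm_iff (hN : N.SmoothOn I) {r q g : smoothFun I} {k : ℝ} :
    N.IsDOpForm c p s r q g k I ↔
      (IsDForm c p s (alphaCoef hN) ∧ jf (alphaCoef hN 0) = k • jf r) ∧
      (IsDForm c p s (betaCoef hN) ∧ jf (betaCoef hN 0) = k • jf q) ∧
      jf (eCoef hN) = k • jf g := by
  refine and_congr ?_ (and_congr ?_ ?_)
  · rw [← normalJet_eq_smul_dForm_iff]
    exact forall_congr' fun ε => ext_jet (restrict_alpha hN ε) (restrict_dOp c p s r ε)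
  · rw [← normalJet_eq_smul_dForm_iff]
    exact forall_congr' fun ε => ext_jet (restrict_beta hN ε) (restrict_dOp c p s q ε)
  · rw [← map_smul, jf_eq_iff]
    rfl

lemma isMultipleOn_iff (hN : N.SmoothOn I) (hM : M.SmoothOn I) {k : ℝ} :
    N.IsMultipleOn M k I ↔ ∀ ε, el (stringJet (alphaCoef hN) (betaCoef hN) (eCoef hN) ε) =
      k • el (stringJet (alphaCoef hM) (betaCoef hM) (eCoef hM) ε) :=
  forall_congr' fun ε =>
    ext_jet (restrict_euler (restrict_density hN ε)) (restrict_euler (restrict_density hM ε))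

lemma ne_zero_of_nonzeroOn (hdiv : ∀ f : smoothFun I, jf f * jf (sd 3 h) = 0 → jf f = 0)
    (hN : N.SmoothOn I) (h0 : N.NonzeroOn I) {k : ℝ}
    (ha : IsDForm c p s (alphaCoef hN)) (hb : IsDForm c p s (betaCoef hN))
    (hab : jf (sd 1 (betaCoef hN 0)) = jf (sd 1 (alphaCoef hN 0)) * jf (sd 2 h))
    (hk : jf (sd 1 (alphaCoef hN 0)) = k • jf ci)
    (H : StringEquations (cj (alphaCoef hN)) (cj (betaCoef hN)) (cj (dForm c p s h))
      (fun n => jf (sd n (eCoef hN)))) : k ≠ 0 := by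
  rintro rfl
  rw [zero_smul] at hk
  rw [hk, zero_mul] at hab
  have he := H.jf_eq_zero hdiv ha hb hk hab
  -- With `k = 0` the data `α₀'`, `β₀'`, `e` all vanish, so the functional is zero times itself.
  have hz : N.IsMultipleOn N 0 I := (isMultipleOn_iff hN hN).2 fun ε =>
    el_stringJet_eq_smul ha hb ha hb (by rw [hk, smul_zero]) (by rw [hab, smul_zero])
      (by rw [he, smul_zero]) ε
  obtain ⟨ε, x, t, j, hj, hne⟩ := h0
  exact hne (by rw [hz ε x t j hj, zero_mul])

lemma nonzeroOn_of_ne_zero (hI : (I : Set ℝ).Nonempty) (hci0 : ∀ v ∈ I, ci.1 v ≠ 0)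
    (hN : N.SmoothOn I) {k : ℝ} (hk0 : k ≠ 0) (hk : jf (sd 1 (alphaCoef hN 0)) = k • jf ci) :
    N.NonzeroOn I := by
  obtain ⟨v, hv⟩ := hI
  -- At `ε = 0`, `x = 1`, `t = 0` the variational derivative is `α₀' = k/c`.
  refine ⟨0, 1, 0, fun _ => v, hv, ?_⟩
  rw [euler_eq_ev (restrict_density hN 0) 1 0 _ hv, el_stringJet]
  simp only [cj, hk, map_add, map_mul, map_smul, ev_jx, ev_jt, ev_jf, smul_eq_mul]
  simpa [hk0] using hci0 v hv

/-- The form `x D(r) + ε⁴ g u_x³ + t D(q)`. -/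
def ofGenerator (c p s r q g : smoothFun I) : StringForm where
  α₀ := dForm c p s r 0
  α₁ := dForm c p s r 1
  α₂ := dForm c p s r 2
  α₃ := dForm c p s r 3
  β₀ := dForm c p s q 0
  β₁ := dForm c p s q 1
  β₂ := dForm c p s q 2
  β₃ := dForm c p s q 3
  e := g

lemma ofGenerator_smoothOn (c p s r q g : smoothFun I) : (ofGenerator c p s r q g).SmoothOn I :=
  ⟨⟨(dForm c p s r 0).2, (dForm c p s r 1).2, (dForm c p s r 2).2, (dForm c p s r 3).2⟩,
    ⟨(dForm c p s q 0).2, (dForm c p s q 1).2, (dForm c p s q 2).2, (dForm c p s q 3).2⟩, g.2⟩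

lemma ofGenerator_isDOpForm (c p s r q g : smoothFun I) :
    (ofGenerator c p s r q g).IsDOpForm c p s r q g 1 I := by
  rw [isDOpForm_iff (ofGenerator_smoothOn c p s r q g)]
  simp only [one_smul]
  exact ⟨⟨isDForm_of_jf_eq rfl rfl rfl, rfl⟩, ⟨isDForm_of_jf_eq rfl rfl rfl, rfl⟩, rfl⟩

lemma IsDOpForm.congr {c p s r q g g' : ℝ → ℝ} {k : ℝ} {I : Set ℝ} (hg : ∀ v ∈ I, g v = g' v) :
    N.IsDOpForm c p s r q g k I ↔ N.IsDOpForm c p s r q g' k I :=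
  and_congr_right' <| and_congr_right' <| forall₂_congr fun v hv => by rw [hg v hv]

end StringForm

end

/-! ### The main theorem. -/

open JetSpace StringForm in
theorem mainTheorem3 (I : Set ℝ) (hIo : IsOpen I) (hIc : IsConnected I)
    (h c p s : ℝ → ℝ)
    (hh : ContDiffOn ℝ ∞ h I) (hc : ContDiffOn ℝ ∞ c I)
    (hp : ContDiffOn ℝ ∞ p I) (hs : ContDiffOn ℝ ∞ s I)
    (hc0 : ∀ v ∈ I, c v ≠ 0)
    (hh3 : I ⊆ closure {v ∈ I | iteratedDeriv 3 h v ≠ 0}) :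
    -- existence of a nonzero conserved quantity up to `O(ε⁶)`
    ((∃ N : StringForm, N.SmoothOn I ∧ N.NonzeroOn I ∧
        IsConservedUpTo I 6 (hamFlow h c p s) N.density) ↔
      ∃ lam : ℝ, PRelation c p lam I) ∧
    -- its form and its uniqueness
    ∀ lam : ℝ, PRelation c p lam I →
      (∃ r q : ℝ → ℝ, IsGenerator h c r q I) ∧
      (∀ r q : ℝ → ℝ, IsGenerator h c r q I →
        ∃ N : StringForm, N.SmoothOn I ∧ N.IsDOpForm c p s r q (gaugeE c s lam) 1 I) ∧
      (∀ N : StringForm, N.SmoothOn I →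
        ((N.NonzeroOn I ∧ IsConservedUpTo I 6 (hamFlow h c p s) N.density) ↔
          ∃ k : ℝ, k ≠ 0 ∧ ∃ r q : ℝ → ℝ, IsGenerator h c r q I ∧
            N.IsDOpForm c p s r q (gaugeE c s lam) k I)) ∧
      (∀ N M : StringForm, N.SmoothOn I → M.SmoothOn I → M.NonzeroOn I →
        IsConservedUpTo I 6 (hamFlow h c p s) N.density →
        IsConservedUpTo I 6 (hamFlow h c p s) M.density →
        ∃ k : ℝ, N.IsMultipleOn M k I) := by
  let O : Opens ℝ := ⟨I, hIo⟩
  let c' : smoothFun O := ⟨c, hc⟩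
  let p' : smoothFun O := ⟨p, hp⟩
  let s' : smoothFun O := ⟨s, hs⟩
  let h' : smoothFun O := ⟨h, hh⟩
  let ci : smoothFun O := ⟨fun v => (c v)⁻¹, hc.inv hc0⟩
  have hdiv : ∀ f : smoothFun O, jf f * jf (sd 3 h') = 0 → jf f = 0 :=
    jf_eq_zero_of_mul_eq_zero hh3
  have hconst : ∀ f : smoothFun O, jf (sd 1 f) = 0 → ∃ k : ℝ, jf f = algebraMap ℝ _ k :=
    exists_jf_eq_const hIc.isPreconnected
  have hci : jf (sd 0 c') * jf ci = 1 := by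
    rw [sd_zero, ← map_mul, ← map_one jf, jf_eq_iff]
    exact fun v hv => mul_inv_cancel₀ (hc0 v hv)
  have hciv : ∀ v ∈ O, ci.1 v = (c'.1 v)⁻¹ := fun _ _ => rfl
  have hci0 : ∀ v ∈ O, ci.1 v ≠ 0 := fun v hv => inv_ne_zero (hc0 v hv)
  have hprel : ∀ lam : ℝ, PRelation c p lam I ↔
      jf p' = (3 / 5 : ℝ) • (jf (sd 0 c') * jf (sd 1 c')) + lam • jf (sd 0 c') ^ 3 := fun lam => by
    rw [sd_zero, ← map_mul, ← map_pow, ← map_smul, ← map_smul, ← map_add, jf_eq_iff]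
    refine forall₂_congr fun v _ => ?_
    change _ ↔ p v = 3 / 5 * (c v * (sd 1 c').1 v) + lam * c v ^ 3
    rw [sd_coe, iteratedDeriv_one, mul_assoc]
  have hgauge : ∀ lam, ∀ v ∈ O, (gaugeForm c' s' ci lam).1 v = gaugeE c s lam v :=
    fun lam v hv => gaugeForm_apply hv hciv
  have hlift : ∀ r q : ℝ → ℝ, IsGenerator h c r q I →
      ∃ r' q' : smoothFun O, r'.1 = r ∧ q'.1 = q := fun r q hrq => by
    refine ⟨⟨r, contDiffOn_of_hasDerivAt (f := ci) fun v hv => ?_⟩,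
      ⟨q, contDiffOn_of_hasDerivAt (f := sd 2 h' * ci) fun v hv => ?_⟩, rfl, rfl⟩
    · simpa [ci] using (hrq v hv).1
    · simpa [ci, h', div_eq_mul_inv] using (hrq v hv).2
  have hform : ∀ lam : ℝ, PRelation c p lam I → ∀ N : StringForm, N.SmoothOn I →
      ((N.NonzeroOn I ∧ IsConservedUpTo I 6 (hamFlow h c p s) N.density) ↔
        ∃ k : ℝ, k ≠ 0 ∧ ∃ r q : ℝ → ℝ, IsGenerator h c r q I ∧
          N.IsDOpForm c p s r q (gaugeE c s lam) k I) := by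
    intro lam hlam (N : StringForm) (hN : N.SmoothOn O)
    have hcons : IsConservedUpTo I 6 (hamFlow h c p s) N.density ↔ _ :=
      (isConservedUpTo_iff_stringEquations (c := c') (p := p') (s := s') (h := h') hN).trans
        (stringEquations_dForm_iff hdiv hconst hci ((hprel lam).1 hlam))
    constructor
    · rintro ⟨h0, H⟩
      obtain ⟨ha, hb, k, hk, hbk, he⟩ := hcons.1 H
      have hk0 : k ≠ 0 := ne_zero_of_nonzeroOn hdiv hN h0 ha hb
        (by rw [hbk, hk, smul_mul_assoc, mul_comm]) hk
        ((isConservedUpTo_iff_stringEquations hN).1 H)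
      -- The generators are `r = α₀/k` and `q = β₀/k`.
      refine ⟨k, hk0, (k⁻¹ • alphaCoef hN 0 : smoothFun O), (k⁻¹ • betaCoef hN 0 : smoothFun O),
        (isGenerator_iff (h := h') hciv).2 ⟨?_, ?_⟩, ?_⟩
      · rw [← pd_zero_jf_eq, map_smul, Derivation.map_smul, pd_zero_jf_eq, hk, inv_smul_smul₀ hk0]
      · rw [← pd_zero_jf_eq, map_smul, Derivation.map_smul, pd_zero_jf_eq, hbk, inv_smul_smul₀ hk0]
      · refine (IsDOpForm.congr (hgauge lam)).1 ((isDOpForm_iff (c := c') (p := p') (s := s') hN).2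
          ⟨⟨ha, ?_⟩, ⟨hb, ?_⟩, he⟩) <;> rw [map_smul, smul_inv_smul₀ hk0]
    · rintro ⟨k, hk0, r, q, hrq, H⟩
      obtain ⟨r', q', rfl, rfl⟩ := hlift r q hrq
      obtain ⟨hr, hq⟩ := (isGenerator_iff (c := c') (h := h') (r := r') (q := q') hciv).1 hrq
      obtain ⟨⟨ha, ha0⟩, ⟨hb, hb0⟩, he⟩ :=
        (isDOpForm_iff (c := c') (p := p') (s := s') (r := r') (q := q') hN).1
          ((IsDOpForm.congr (hgauge lam)).2 H)
      have hk : jf (sd 1 (alphaCoef hN 0)) = k • jf ci := by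
        rw [← pd_zero_jf_eq, ha0, Derivation.map_smul, pd_zero_jf_eq, hr]
      have hbk : jf (sd 1 (betaCoef hN 0)) = k • (jf (sd 2 h') * jf ci) := by
        rw [← pd_zero_jf_eq, hb0, Derivation.map_smul, pd_zero_jf_eq, hq]
      exact ⟨nonzeroOn_of_ne_zero hIc.nonempty hci0 hN hk0 hk, hcons.2 ⟨ha, hb, k, hk, hbk, he⟩⟩
  have hgen : ∃ r q : ℝ → ℝ, IsGenerator h c r q I := by
    obtain ⟨r, hr⟩ := exists_primitive (I := O) hIc ci
    obtain ⟨q, hq⟩ := exists_primitive (I := O) hIc (sd 2 h' * ci)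
    refine ⟨r, q, fun v hv => ⟨?_, ?_⟩⟩
    · simpa [ci] using hr v hv
    · simpa [ci, h', div_eq_mul_inv] using hq v hv
  have hexists : ∀ lam : ℝ, ∀ r q : ℝ → ℝ, IsGenerator h c r q I →
      ∃ N : StringForm, N.SmoothOn I ∧ N.IsDOpForm c p s r q (gaugeE c s lam) 1 I := by
    intro lam r q hrq
    obtain ⟨r', q', rfl, rfl⟩ := hlift r q hrq
    exact ⟨ofGenerator c' p' s' r' q' (gaugeForm c' s' ci lam), ofGenerator_smoothOn ..,
      (IsDOpForm.congr (hgauge lam)).1 (ofGenerator_isDOpForm ..)⟩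
  refine ⟨⟨?_, fun ⟨lam, hlam⟩ => ?_⟩, fun lam hlam =>
    ⟨hgen, hexists lam, hform lam hlam, fun N M hN hM hM0 hNc hMc => ?_⟩⟩
  -- Here `λ` is not yet known, so `hform` is unavailable. First `k ≠ 0` is obtained without any
  -- relation on `p`, then the `u_xx²` equation produces `λ`.
  · rintro ⟨N, hN, h0, H⟩
    replace H := (isConservedUpTo_iff_stringEquations (c := c') (p := p') (s := s') (h := h')
      (I := O) hN).1 H
    obtain ⟨ha, hb, hab, k, hk⟩ := H.necessary hdiv hconst hci
    have hk0 := ne_zero_of_nonzeroOn hdiv (I := O) hN h0 ha hb hab hk H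
    obtain ⟨lam, hlam⟩ := H.exists_relation hdiv hconst hci hk0 hk
    exact ⟨lam, (hprel lam).2 hlam⟩
  · obtain ⟨r, q, hrq⟩ := hgen
    obtain ⟨N, hN, hD⟩ := hexists lam r q hrq
    exact ⟨N, hN, (hform lam hlam N hN).2 ⟨1, one_ne_zero, r, q, hrq, hD⟩⟩
  · have hp' := (hprel lam).1 hlam
    replace hNc := (isConservedUpTo_iff_stringEquations (c := c') (p := p') (s := s') (h := h')
      (I := O) hN).1 hNc
    replace hMc := (isConservedUpTo_iff_stringEquations (c := c') (p := p') (s := s') (h := h')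
      (I := O) hM).1 hMc
    obtain ⟨ha, hb, k, hk, hbk, he⟩ := (stringEquations_dForm_iff hdiv hconst hci hp').1 hNc
    obtain ⟨ha', hb', l, hl, hbl, he'⟩ := (stringEquations_dForm_iff hdiv hconst hci hp').1 hMc
    have hl0 : l ≠ 0 := ne_zero_of_nonzeroOn hdiv (I := O) hM hM0 ha' hb'
      (by rw [hbl, hl, smul_mul_assoc, mul_comm]) hl hMc
    -- `k` and `l` are the scales of the two quantities; nonvanishing of `M` gives `l ≠ 0`.
    refine ⟨k / l, (isMultipleOn_iff (I := O) hN hM).2 fun ε =>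
      el_stringJet_eq_smul ha hb ha' hb' ?_ ?_ ?_ ε⟩
    · rw [hk, hl, smul_smul, div_mul_cancel₀ _ hl0]
    · rw [hbk, hbl, smul_smul, div_mul_cancel₀ _ hl0]
    · rw [he, he', smul_smul, div_mul_cancel₀ _ hl0]
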